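/- **Lemma (Termination).** *Setting.* Let $\mathbf Q_0\subseteq\mathbb Q\cap(0,1)$. Roles are role names $R$ and their inverses $R^-$ ($\mathsf{Inv}(R)=R^-$, $\mathsf{Inv}(R^-)=R$); some role names are transitive, and a role is transitive if it is a transitive role name or the inverse of one. A role hierarchy $\mathcal R^+$ is given by a finite set $\mathcal R$ of inclusions $R\sqsubseteq S$ between roles; $\sqsubseteq^+$ is the reflexive transitive closure of $\sqsubseteq$ over $\mathcal R\cup\{\mathsf{Inv}(R)\sqsubseteq\mathsf{Inv}(S)\mid R\sqsubseteq S\in\mathcal R\}$, and it is acyclic (antisymmetric). A role is simple if no $S\sqsubseteq^+R$ is transitive. $\mathcal{ALCQPIH}_{R^+}$-concepts are built from concept names by $\neg,\sqcap,\sqcup$, by $\forall R.C,\exists R.C$, and, for simple $R$, $n\ge 0$, $r\in\mathbf Q_0$, by $\geqslant nR.C$, $\leqslant nR.C$, $MrR.C$ (more than the part $r$ of the $R$-neighbours is in $C$) and $WrR.C$ (at most the part $r$ of the $R$-neighbours is not in $C$). ${\sim}C$ is the negation normal form (NNF) of $\neg C$. $\boxtimes$ stands for any of $\exists,\geqslant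 n,\leqslant n,Mr,Wr$. *Completion trees.* A completion tree $\mathbf T$ is a finite tree whose nodes carry sets $\mathcal L(x)$ of concepts and whose edges carry sets $\mathcal L(\langle x,y\rangle)$ of roles; if $z$ is the predecessor of $x$, then $\mathcal L(\langle x,z\rangle)$ means $\{\mathsf{Inv}(S)\mid S\in\mathcal L(\langle z,x\rangle)\}$. A successor $y$ of $x$ is an $R$-successor if some $S\in\mathcal L(\langle x,y\rangle)$ has $S\sqsubseteq^+R$; $y$ is an $R$-neighbour of $x$ if $y$ is an $R$-successor of $x$ or $x$ is an $\mathsf{Inv}(R)$-successor of $y$. $R^{\mathbf T}(x)$ is the set of $R$-neighbours of $x$, and $R^{\mathbf T}(x,C)$ the set of those labelled with $C$. A node $x$ with predecessor $x'$ is directly blocked if none of its ancestors is blocked and it has a proper ancestor $y$ with predecessor $y'$ such that $\mathcal L(x)=\mathcal L(y)$, $\mathcal L(x')=\mathcal L(y')$, $\mathcal L(\langle x',x\rangle)=\mathcal L(\langle y',y\rangle)$; it is indirectly blocked if its predecessor is blocked or $\mathcal L(\langle x',x\rangle)=\emptyset$; blocked means directly or indirectly blocked. *The algorithm* starts, for a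 concept $D$ in NNF, with a single node labelled $\{D\}$ and applies the following rules. Non-generating rules, for $x$ not indirectly blocked: ($\sqcap$) if $C_1\sqcap C_2\in\mathcal L(x)$ and $\{C_1,C_2\}\not\subseteq\mathcal L(x)$, add $C_1,C_2$ to $\mathcal L(x)$; ($\sqcup$) if $C_1\sqcup C_2\in\mathcal L(x)$ and $\{C_1,C_2\}\cap\mathcal L(x)=\emptyset$, add $C_1$ or $C_2$; ($\forall$) if $\forall R.C\in\mathcal L(x)$ and an $R$-neighbour $y$ has $C\notin\mathcal L(y)$, add $C$ to $\mathcal L(y)$; ($\forall_+$) if $\forall S.C\in\mathcal L(x)$, $R\sqsubseteq^+S$ is transitive and an $R$-neighbour $y$ has $\forall R.C\notin\mathcal L(y)$, add $\forall R.C$ to $\mathcal L(y)$; (choose) if $\boxtimes R.C\in\mathcal L(x)$ and an $R$-neighbour $y$ has $\{C,{\sim}C\}\cap\mathcal L(y)=\emptyset$, add $C$ or ${\sim}C$ to $\mathcal L(y)$; ($\leqslant$) if $\leqslant nR.C\in\mathcal L(x)$, $\sharp R^{\mathbf T}(x,C)>n$ and $y\neq z$ in $R^{\mathbf T}(x,C)$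 satisfy $\mathcal L(\langle x,y\rangle)\cap\mathcal L(\langle x,z\rangle)=\emptyset$, $y$ not the predecessor of $x$, then add $\mathcal L(y)$ to $\mathcal L(z)$, add $\mathcal L(\langle x,y\rangle)$ to $\mathcal L(\langle x,z\rangle)$ (if $z$ is the predecessor of $x$: add the inverses of its roles to $\mathcal L(\langle z,x\rangle)$), and set $\mathcal L(\langle x,y\rangle)=\emptyset$. Generating rules, for $x$ not blocked, each creating a new successor $y$ of $x$ with $\mathcal L(\langle x,y\rangle)=\{R\}$, $\mathcal L(y)=\{C\}$: ($\exists$) if $\exists R.C\in\mathcal L(x)$ and $R^{\mathbf T}(x,C)=\emptyset$; ($\geqslant$) if $\geqslant nR.C\in\mathcal L(x)$ and $\sharp R^{\mathbf T}(x,C)<n$; ($M$) if $MrR.C\in\mathcal L(x)$, $\sharp R^{\mathbf T}(x,C)\le r\,\sharp R^{\mathbf T}(x)$ and $\sharp R^{\mathbf T}(x)<BAN_x$; ($W$) if $WrR.C\in\mathcal L(x)$, $\sharp R^{\mathbf T}(x,{\sim}C)>r\,\sharp R^{\mathbf T}(x)$ and $\sharp R^{\mathbf T}(x)<BAN_x$.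 A generating rule is applied only if no non-generating rule is applicable anywhere in the tree; otherwise all choices are free. *The number $BAN_x$.* Let $\bar n$ be the sum of the numbers $n$ over all restrictions $\geqslant nS.E$ in the set obtained from $\mathcal L(x)$ by replacing each $\exists S.E$ with $\geqslant 1S.E$ and adding $\geqslant 1S.E$ whenever $x$ is an $\mathsf{Inv}(S)$-successor of its predecessor $u$ and $E\in\mathcal L(u)$. Put $\bar r=r$ for $MrR.C$ and $\bar r=1-r$ for $WrR.C$. Let $\mathbf R^P_x$ be the set of outermost roles of the part restrictions ($M$- and $W$-concepts) in $\mathcal L(x)$. For $R\in\mathbf R^P_x$ let $B_R=\bar n$ if $R$ has no proper sub-role in $\mathbf R^P_x$, and otherwise let $B_R$ be the sum of $N_S$ over the direct (i.e. maximal proper) sub-roles $S$ of $R$ in $\mathbf R^P_x$; let $N_R$ be the maximum of $\lfloor B_R/(1-\sum_{K}\bar r)\rfloor+|K|$ over the nonempty sets $K$ of part restrictions in $\mathcal L(x)$ with role $R$ and $\sum_K\bar r<1$, and $N_R=1$ if there is no such $K$. Then $BAN_x$ is the maximum of $N_R$ over the roles $R$ maximal in $\mathbf R^P_x$, times the least common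 multiple of the (reduced) denominators of the indices $r'$ of those $Wr'R.C\in\mathcal L(x)$ for which the indices of some $k\ge 1$ other $W$-concepts in $\mathcal L(x)$ sum up to $1-r'$ (the factor is $1$ if there are none). *Claim.* For every $\mathcal{ALCQPIH}_{R^+}$-concept $D$ in NNF and every role hierarchy $\mathcal R^+$ the algorithm terminates: there is a number $N$, depending on $D$ and $\mathcal R^+$, such that every sequence of rule applications starting from the initial tree has length at most $N$. Moreover, let $n_0=|D|$ be the number of symbols of $D$ (numbers in binary), and let $k$ be the number of the roles which occur in $D$ or in $\mathcal R$, together with their inverses. Then in every tree generated by the algorithm 1. all paths from the root have length at most $2^{4n_0k}$; 2. every node has at most $c\cdot 2^{m^2}$ successors, where $m=\max(n_0,k/2)$ and $c$ is an absolute constant. In particular, the out-degree is bounded by $O(2^{n_0^2})$ if $k\le 2n_0$, which is the case whenever all roles of $\mathcal R$ occur, up to inverses, in $D$. -/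

import Mathlib

open scoped Classical

universe u v

namespace ALCQPIH

/-! ### Roles and role hierarchies -/

/-- A role is a role name or the inverse of a role name. -/
inductive Role (NR : Type v) : Type v
  | name : NR → Role NR
  | inv : NR → Role NR

/-- The function `Inv`. -/
def Role.Inv {NR : Type v} : Role NR → Role NR
  | .name a => .inv a
  | .inv a => .name a

/-- `R ⊑ S` is an axiom of `ax`, or `Inv R ⊑ Inv S` is one. -/
def BaseSub {NR : Type v} (ax : Finset (Role NR × Role NR)) (R S : Role NR) : Prop :=
  (R, S) ∈ ax ∨ (R.Inv, S.Inv) ∈ ax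

/-- A finite set of role inclusion axioms without cycles, together with the set of
the transitive role names. -/
structure Hierarchy (NR : Type v) where
  transNames : Set NR
  ax : Finset (Role NR × Role NR)
  acyclic : ∀ R S : Role NR, Relation.ReflTransGen (BaseSub ax) R S →
    Relation.ReflTransGen (BaseSub ax) S R → R = S

namespace Hierarchy

variable {NR : Type v} (H : Hierarchy NR)

/-- `R ⊑⁺ S`: the reflexive and transitive closure of `⊑`. -/
def Sub (R S : Role NR) : Prop := Relation.ReflTransGen (BaseSub H.ax) R S

/-- `R` is a proper sub-role of `S`. -/
def SSub (R S : Role NR) : Prop := H.Sub R S ∧ R ≠ S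

theorem SSub.trans {H : Hierarchy NR} {R S P : Role NR} (h : H.SSub R S) (h' : H.SSub S P) :
    H.SSub R P := by
  refine ⟨Relation.ReflTransGen.trans h.1 h'.1, ?_⟩
  rintro rfl
  exact h.2 (H.acyclic _ _ h.1 h'.1)

/-- A role is transitive if it is a transitive role name or the inverse of one. -/
def Trans : Role NR → Prop
  | .name a => a ∈ H.transNames
  | .inv a => a ∈ H.transNames

/-- A role is simple if neither it nor any of its sub-roles is transitive. -/
def Simple (R : Role NR) : Prop := ∀ S, H.Sub S R → ¬ H.Trans S

/-- The roles that occur in the axioms, and their inverses. -/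
noncomputable def roles : Finset (Role NR) :=
  let A := H.ax.image Prod.fst ∪ H.ax.image Prod.snd
  A ∪ A.image Role.Inv

/-- The finite set of all `S` with `R ⊑⁺ S`. -/
noncomputable def supers (R : Role NR) : Finset (Role NR) :=
  insert R (H.roles.filter fun S => H.Sub R S)

end Hierarchy

/-! ### Concepts -/

inductive Concept (NC : Type u) (NR : Type v) : Type (max u v)
  | atom : NC → Concept NC NR
  | neg : Concept NC NR → Concept NC NR
  | and : Concept NC NR → Concept NC NR → Concept NC NR
  | or : Concept NC NR → Concept NC NR → Concept NC NR
  | all : Role NR → Concept NC NR → Concept NC NR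
  | ex : Role NR → Concept NC NR → Concept NC NR
  | atLeast : ℕ → Role NR → Concept NC NR → Concept NC NR
  | atMost : ℕ → Role NR → Concept NC NR → Concept NC NR
  /-- `M r R.C`: more than the part `r` of the `R`-neighbours is in `C`. -/
  | M : ℚ → Role NR → Concept NC NR → Concept NC NR
  /-- `W r R.C`: at most the part `r` of the `R`-neighbours is not in `C`. -/
  | W : ℚ → Role NR → Concept NC NR → Concept NC NR

namespace Concept

variable {NC : Type u} {NR : Type v}

/-- The formation rules: number restrictions and part restrictions carry simple roles only,
and the indices of the part restrictions come from `Q₀`. -/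
def IsConcept (Q₀ : Set ℚ) (H : Hierarchy NR) : Concept NC NR → Prop
  | atom _ => True
  | neg C => C.IsConcept Q₀ H
  | and C D => C.IsConcept Q₀ H ∧ D.IsConcept Q₀ H
  | or C D => C.IsConcept Q₀ H ∧ D.IsConcept Q₀ H
  | all _ C => C.IsConcept Q₀ H
  | ex _ C => C.IsConcept Q₀ H
  | atLeast _ R C => H.Simple R ∧ C.IsConcept Q₀ H
  | atMost _ R C => H.Simple R ∧ C.IsConcept Q₀ H
  | M r R C => r ∈ Q₀ ∧ H.Simple R ∧ C.IsConcept Q₀ H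
  | W r R C => r ∈ Q₀ ∧ H.Simple R ∧ C.IsConcept Q₀ H

/-- The first concept name that occurs in a concept. -/
def firstName : Concept NC NR → NC
  | atom A => A
  | neg C => C.firstName
  | and C _ => C.firstName
  | or C _ => C.firstName
  | all _ C => C.firstName
  | ex _ C => C.firstName
  | atLeast _ _ C => C.firstName
  | atMost _ _ C => C.firstName
  | M _ _ C => C.firstName
  | W _ _ C => C.firstName

/-- `nnfAux true C` is the negation normal form of `C`, and `nnfAux false C` that of `¬ C`.
The negation of the tautology `≥ 0 R.C` is the contradiction `A ⊓ ¬A`, for a concept name `A`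
that occurs in `C`. -/
def nnfAux : Bool → Concept NC NR → Concept NC NR
  | true, atom A => atom A
  | false, atom A => neg (atom A)
  | b, neg C => nnfAux (!b) C
  | true, and C D => and (nnfAux true C) (nnfAux true D)
  | false, and C D => or (nnfAux false C) (nnfAux false D)
  | true, or C D => or (nnfAux true C) (nnfAux true D)
  | false, or C D => and (nnfAux false C) (nnfAux false D)
  | true, all R C => all R (nnfAux true C)
  | false, all R C => ex R (nnfAux false C)
  | true, ex R C => ex R (nnfAux true C)
  | false, ex R C => all R (nnfAux false C)
  | true, atLeast n R C => atLeast n R (nnfAux true C)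
  | false, atLeast 0 _ C => and (atom C.firstName) (neg (atom C.firstName))
  | false, atLeast (n + 1) R C => atMost n R (nnfAux true C)
  | true, atMost n R C => atMost n R (nnfAux true C)
  | false, atMost n R C => atLeast (n + 1) R (nnfAux true C)
  | true, M r R C => M r R (nnfAux true C)
  | false, M r R C => W r R (nnfAux false C)
  | true, W r R C => W r R (nnfAux true C)
  | false, W r R C => M r R (nnfAux false C)

/-- Negation normal form. -/
def nnf (C : Concept NC NR) : Concept NC NR := nnfAux true C

/-- `∼C`, the negation normal form of `¬ C`. -/
def compl (C : Concept NC NR) : Concept NC NR := nnfAux false C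

/-- The number of binary digits of `n`. -/
def numLength (n : ℕ) : ℕ := max 1 n.size

/-- The length of a concept: the number of its symbols, with numbers in binary. -/
def length : Concept NC NR → ℕ
  | atom _ => 1
  | neg C => 1 + C.length
  | and C D => 1 + C.length + D.length
  | or C D => 1 + C.length + D.length
  | all _ C => 2 + C.length
  | ex _ C => 2 + C.length
  | atLeast n _ C => 2 + numLength n + C.length
  | atMost n _ C => 2 + numLength n + C.length
  | M r _ C => 2 + numLength r.num.natAbs + numLength r.den + C.length
  | W r _ C => 2 + numLength r.num.natAbs + numLength r.den + C.length

/-- The roles that occur in a concept. -/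
noncomputable def occRoles : Concept NC NR → Finset (Role NR)
  | atom _ => ∅
  | neg C => C.occRoles
  | and C D => C.occRoles ∪ D.occRoles
  | or C D => C.occRoles ∪ D.occRoles
  | all R C => insert R C.occRoles
  | ex R C => insert R C.occRoles
  | atLeast _ R C => insert R C.occRoles
  | atMost _ R C => insert R C.occRoles
  | M _ R C => insert R C.occRoles
  | W _ R C => insert R C.occRoles

/-- The roles that occur in `D` or in the role hierarchy, and their inverses. -/
noncomputable def rolesWith (D : Concept NC NR) (H : Hierarchy NR) : Finset (Role NR) :=
  D.occRoles ∪ D.occRoles.image Role.Inv ∪ H.roles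

/-- The pair `(R, C)` of a concept `⊠ R.C`, where `⊠` is one of `∃`, `≥ n`, `≤ n`, `M r`, `W r`. -/
def box : Concept NC NR → Option (Role NR × Concept NC NR)
  | ex R C => some (R, C)
  | atLeast _ R C => some (R, C)
  | atMost _ R C => some (R, C)
  | M _ R C => some (R, C)
  | W _ R C => some (R, C)
  | _ => none

/-- The uppermost role of a part restriction. -/
def partRole : Concept NC NR → Option (Role NR)
  | M _ R _ => some R
  | W _ R _ => some R
  | _ => none

/-- The index `r̄` of a part restriction: `r` for `M r R.C`, and `1 - r` for `W r R.C`. -/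
def rbar : Concept NC NR → ℚ
  | M r _ _ => r
  | W r _ _ => 1 - r
  | _ => 0

/-- The index `r` of a `W` part restriction. -/
def wIndex : Concept NC NR → Option ℚ
  | W r _ _ => some r
  | _ => none

/-- `∃ R.C` is replaced with `≥ 1 R.C`. -/
def exToAtLeast : Concept NC NR → Concept NC NR
  | ex R C => atLeast 1 R C
  | C => C

/-- The number `n` of an "at least" restriction `≥ n R.C`, and `0` for other concepts. -/
def atLeastNum : Concept NC NR → ℕ
  | atLeast n _ _ => n
  | _ => 0

end Concept

/-! ### The border amount of neighbours -/

section BAN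

variable {NC : Type u} {NR : Type v}

/-- The roles at the uppermost level in the part restrictions of a label. -/
noncomputable def partRoles (L : Finset (Concept NC NR)) : Finset (Role NR) :=
  L.biUnion fun C => C.partRole.toFinset

/-- The part restrictions of a label with uppermost role `R`. -/
noncomputable def cluster (L : Finset (Concept NC NR)) (R : Role NR) : Finset (Concept NC NR) :=
  L.filter fun C => C.partRole = some R

/-- The direct sub-roles of `R` among the part roles of a label. -/
noncomputable def directSubs (H : Hierarchy NR) (L : Finset (Concept NC NR)) (R : Role NR) :
    Finset (Role NR) :=
  (partRoles L).filter fun S => H.SSub S R ∧ ¬ ∃ P ∈ partRoles L, H.SSub S P ∧ H.SSub P R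

/-- The combinations of part restrictions of a cluster whose indices sum up to less than `1`. -/
noncomputable def combinations (Cl : Finset (Concept NC NR)) : Finset (Finset (Concept NC NR)) :=
  Cl.powerset.filter fun K => K.Nonempty ∧ ∑ C ∈ K, C.rbar < 1

/-- The satisfaction number of a cluster over the base number `B`. -/
noncomputable def clusterNum (Cl : Finset (Concept NC NR)) (B : ℕ) : ℕ :=
  if (combinations Cl).Nonempty then
    (combinations Cl).sup fun K => ⌊(B : ℚ) / (1 - ∑ C ∈ K, C.rbar)⌋₊ + K.card
  else 1

theorem card_lt_of_mem_directSubs {H : Hierarchy NR} {L : Finset (Concept NC NR)}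
    {R S : Role NR} (hS : S ∈ directSubs H L R) :
    ((partRoles L).filter fun P => H.SSub P S).card <
      ((partRoles L).filter fun P => H.SSub P R).card := by
  obtain ⟨hSL, hSR, -⟩ := Finset.mem_filter.1 hS
  refine Finset.card_lt_card ⟨fun P hP => ?_, fun h => ?_⟩
  · obtain ⟨h1, h2⟩ := Finset.mem_filter.1 hP
    exact Finset.mem_filter.2 ⟨h1, h2.trans hSR⟩
  · exact (Finset.mem_filter.1 (h (Finset.mem_filter.2 ⟨hSL, hSR⟩))).2.2 rfl

/-- The satisfaction number of the role `R`. The base number is `nbar` for an initial role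
(one without proper sub-roles among the part roles), and the sum of the satisfaction numbers of
the direct sub-roles for any other role. -/
noncomputable def satNum (H : Hierarchy NR) (L : Finset (Concept NC NR)) (nbar : ℕ)
    (R : Role NR) : ℕ :=
  clusterNum (cluster L R)
    (if ∀ S ∈ partRoles L, ¬ H.SSub S R then nbar
     else ∑ S ∈ (directSubs H L R).attach, satNum H L nbar S.1)
termination_by ((partRoles L).filter fun P => H.SSub P R).card
decreasing_by exact card_lt_of_mem_directSubs S.2

/-- The maximum of the satisfaction numbers of the final roles. -/
noncomputable def banClusters (H : Hierarchy NR) (L : Finset (Concept NC NR)) (nbar : ℕ) : ℕ :=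
  ((partRoles L).filter fun R => ∀ S ∈ partRoles L, ¬ H.SSub R S).sup (satNum H L nbar)

/-- The `W` part restrictions of `L` whose index, together with the indices of one or more other
`W` part restrictions of `L`, sums up to `1`. -/
noncomputable def wOne (L : Finset (Concept NC NR)) : Finset (Concept NC NR) :=
  L.filter fun C => ∃ r, C.wIndex = some r ∧
    ∃ K ⊆ (L.erase C).filter (fun E => E.wIndex.isSome),
      K.Nonempty ∧ ∑ E ∈ K, E.wIndex.getD 0 + r = 1

/-- The least common multiple of the denominators of the indices in `wOne L` (`1` if there is none). -/
noncomputable def lcmOne (L : Finset (Concept NC NR)) : ℕ :=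
  (wOne L).lcm fun C => (C.wIndex.getD 0).den

end BAN

/-! ### Completion trees -/

/-- The nodes are addresses: `[]` is the root, and the successors of `x` are of the form `i :: x`.
`edge (i :: x)` is the label of the edge from `x` to `i :: x`. -/
structure CTree (NC : Type u) (NR : Type v) where
  nodes : Finset (List ℕ)
  label : List ℕ → Finset (Concept NC NR)
  edge : List ℕ → Finset (Role NR)

/-- The address `y` is a successor of the address `x`. -/
def IsSucc (y x : List ℕ) : Prop := ∃ i : ℕ, y = i :: x

namespace CTree

variable {NC : Type u} {NR : Type v}

/-- The initial tree: a single node labelled with `{D}`. -/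
noncomputable def init (D : Concept NC NR) : CTree NC NR where
  nodes := {[]}
  label := fun x => if x = [] then {D} else ∅
  edge := fun _ => ∅

variable (T : CTree NC NR)

/-- The number of successors of `x`. -/
noncomputable def outDegree (x : List ℕ) : ℕ := (T.nodes.filter fun y => IsSucc y x).card

/-- `y` is an `R`-successor of `x`. -/
def RSucc (H : Hierarchy NR) (R : Role NR) (x y : List ℕ) : Prop :=
  IsSucc y x ∧ ∃ S ∈ T.edge y, H.Sub S R

/-- `y` is an `R`-neighbour of `x`. -/
def RNbr (H : Hierarchy NR) (R : Role NR) (x y : List ℕ) : Prop :=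
  T.RSucc H R x y ∨ T.RSucc H R.Inv y x

/-- The set of the `R`-neighbours of `x`. -/
noncomputable def nbrs (H : Hierarchy NR) (R : Role NR) (x : List ℕ) : Finset (List ℕ) :=
  T.nodes.filter fun y => T.RNbr H R x y

/-- The set of the `R`-neighbours of `x` labelled with `C`. -/
noncomputable def nbrsWith (H : Hierarchy NR) (R : Role NR) (x : List ℕ) (C : Concept NC NR) :
    Finset (List ℕ) :=
  (T.nbrs H R x).filter fun y => C ∈ T.label y

/-- The label of the edge between `x` and its neighbour `z`, read from `x` to `z`: if `z` is the
predecessor of `x`, it consists of the inverses of the roles on the edge from `z` to `x`. -/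
noncomputable def edgeBetween (x z : List ℕ) : Finset (Role NR) :=
  if IsSucc z x then T.edge z
  else if IsSucc x z then (T.edge x).image Role.Inv
  else ∅

/-- Some proper ancestor `y` of `x`, with predecessor `y'`, has the same label as `x`, and the
labels of the predecessors and those of the edges leading to `x` and `y` also coincide. -/
def PairMatch : List ℕ → Prop
  | [] => False
  | i :: x' => ∃ (j : ℕ) (y' : List ℕ), (j :: y') <:+ x' ∧
      T.label (i :: x') = T.label (j :: y') ∧ T.label x' = T.label y' ∧
      T.edge (i :: x') = T.edge (j :: y')

/-- `x` is blocked, directly or indirectly; `blocked_iff` below is the definition in words. -/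
def Blocked : List ℕ → Prop
  | [] => False
  | i :: x' => Blocked x' ∨ T.edge (i :: x') = ∅ ∨ T.PairMatch (i :: x')

/-- The predecessor of `x` is blocked, or `x` has been merged into another node, so that the edge
leading to `x` has the empty label. -/
def IndirectlyBlocked : List ℕ → Prop
  | [] => False
  | i :: x' => T.Blocked x' ∨ T.edge (i :: x') = ∅

/-- No proper ancestor of `x` is blocked, and `x` matches a proper ancestor. -/
def DirectlyBlocked (x : List ℕ) : Prop :=
  (∀ a, a <:+ x → a ≠ x → ¬ T.Blocked a) ∧ T.PairMatch x

theorem blocked_of_suffix {a : List ℕ} : ∀ {x : List ℕ}, a <:+ x → T.Blocked a → T.Blocked x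
  | [], h, ha => by rwa [List.suffix_nil.1 h] at ha
  | _ :: _, h, ha => by
    rcases List.suffix_cons_iff.1 h with rfl | h
    · exact ha
    · exact Or.inl (blocked_of_suffix h ha)

theorem blocked_iff (x : List ℕ) :
    T.Blocked x ↔ T.DirectlyBlocked x ∨ T.IndirectlyBlocked x := by
  cases x with
  | nil => simp [Blocked, DirectlyBlocked, IndirectlyBlocked, PairMatch]
  | cons i x' =>
    constructor
    · intro h
      by_cases hb : T.Blocked x'
      · exact Or.inr (Or.inl hb)
      · rcases h with h | h | h
        · exact absurd h hb
        · exact Or.inr (Or.inr h)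
        · refine Or.inl ⟨fun a ha hne hab => hb ?_, h⟩
          rcases List.suffix_cons_iff.1 ha with rfl | ha
          · exact absurd rfl hne
          · exact T.blocked_of_suffix ha hab
    · rintro (⟨-, h⟩ | h | h)
      · exact Or.inr (Or.inr h)
      · exact Or.inl h
      · exact Or.inr (Or.inl h)

/-- The restrictions `≥ 1 S.E` assumed in the label of a node `x` on account of its predecessor
`u`: `x` is an `Inv S`-successor of `u`, and `E` is in the label of `u`. -/
noncomputable def inherited (H : Hierarchy NR) : List ℕ → Finset (Concept NC NR)
  | [] => ∅
  | i :: u =>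
    ((((T.edge (i :: u)).biUnion H.supers).image Role.Inv) ×ˢ T.label u).image
      fun p => Concept.atLeast 1 p.1 p.2

/-- The sum of the numbers in all "at least" restrictions at `x`, where `∃ R.C` is read as
`≥ 1 R.C`, and where the restrictions inherited from the predecessor are included. -/
noncomputable def nbar (H : Hierarchy NR) (x : List ℕ) : ℕ :=
  ∑ C ∈ (T.label x).image Concept.exToAtLeast ∪ T.inherited H x, C.atLeastNum

/-- The border amount of neighbours of `x`. -/
noncomputable def BAN (H : Hierarchy NR) (x : List ℕ) : ℕ :=
  banClusters H (T.label x) (T.nbar H x) * lcmOne (T.label x)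

/-! ### The completion rules -/

/-- Add the concepts in `A` to the label of `y`. -/
noncomputable def addConcepts (y : List ℕ) (A : Finset (Concept NC NR)) : CTree NC NR where
  nodes := T.nodes
  label := Function.update T.label y (T.label y ∪ A)
  edge := T.edge

/-- Create the node `y`, with edge label `{R}` and node label `{C}`. -/
noncomputable def addNode (y : List ℕ) (R : Role NR) (C : Concept NC NR) : CTree NC NR where
  nodes := insert y T.nodes
  label := Function.update T.label y {C}
  edge := Function.update T.edge y {R}

/-- Merge the successor `y` of `x` into the neighbour `z` of `x`. -/
noncomputable def merge (x y z : List ℕ) : CTree NC NR where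
  nodes := T.nodes
  label := Function.update T.label z (T.label z ∪ T.label y)
  edge := Function.update
    (if IsSucc x z then Function.update T.edge x (T.edge x ∪ (T.edge y).image Role.Inv)
     else Function.update T.edge z (T.edge z ∪ T.edge y))
    y ∅

/-- The applications of the non-generating rules. -/
inductive NonGen (H : Hierarchy NR) (T : CTree NC NR) : CTree NC NR → Prop
  | and_rule (x : List ℕ) (C₁ C₂ : Concept NC NR) :
      x ∈ T.nodes → Concept.and C₁ C₂ ∈ T.label x → ¬ T.IndirectlyBlocked x →
      ¬ (C₁ ∈ T.label x ∧ C₂ ∈ T.label x) →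
      NonGen H T (T.addConcepts x {C₁, C₂})
  | or_rule (x : List ℕ) (C₁ C₂ E : Concept NC NR) :
      x ∈ T.nodes → Concept.or C₁ C₂ ∈ T.label x → ¬ T.IndirectlyBlocked x →
      C₁ ∉ T.label x → C₂ ∉ T.label x → (E = C₁ ∨ E = C₂) →
      NonGen H T (T.addConcepts x {E})
  | all_rule (x y : List ℕ) (R : Role NR) (C : Concept NC NR) :
      x ∈ T.nodes → Concept.all R C ∈ T.label x → ¬ T.IndirectlyBlocked x →
      y ∈ T.nbrs H R x → C ∉ T.label y →
      NonGen H T (T.addConcepts y {C})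
  | all_plus_rule (x y : List ℕ) (R S : Role NR) (C : Concept NC NR) :
      x ∈ T.nodes → Concept.all S C ∈ T.label x → ¬ T.IndirectlyBlocked x →
      H.Trans R → H.Sub R S →
      y ∈ T.nbrs H R x → Concept.all R C ∉ T.label y →
      NonGen H T (T.addConcepts y {Concept.all R C})
  | choose_rule (x y : List ℕ) (R : Role NR) (B C E : Concept NC NR) :
      x ∈ T.nodes → B ∈ T.label x → B.box = some (R, C) → ¬ T.IndirectlyBlocked x →
      y ∈ T.nbrs H R x → C ∉ T.label y → C.compl ∉ T.label y → (E = C ∨ E = C.compl) →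
      NonGen H T (T.addConcepts y {E})
  | atMost_rule (x y z : List ℕ) (n : ℕ) (R : Role NR) (C : Concept NC NR) :
      x ∈ T.nodes → Concept.atMost n R C ∈ T.label x → ¬ T.IndirectlyBlocked x →
      n < (T.nbrsWith H R x C).card →
      y ∈ T.nbrsWith H R x C → z ∈ T.nbrsWith H R x C → y ≠ z →
      Disjoint (T.edgeBetween x y) (T.edgeBetween x z) → ¬ IsSucc x y →
      NonGen H T (T.merge x y z)

/-- The applications of the generating rules. -/
inductive Gen (H : Hierarchy NR) (T : CTree NC NR) : CTree NC NR → Prop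
  | ex_rule (x y : List ℕ) (R : Role NR) (C : Concept NC NR) :
      x ∈ T.nodes → Concept.ex R C ∈ T.label x → ¬ T.Blocked x →
      T.nbrsWith H R x C = ∅ →
      IsSucc y x → y ∉ T.nodes → Gen H T (T.addNode y R C)
  | atLeast_rule (x y : List ℕ) (n : ℕ) (R : Role NR) (C : Concept NC NR) :
      x ∈ T.nodes → Concept.atLeast n R C ∈ T.label x → ¬ T.Blocked x →
      (T.nbrsWith H R x C).card < n →
      IsSucc y x → y ∉ T.nodes → Gen H T (T.addNode y R C)
  | M_rule (x y : List ℕ) (r : ℚ) (R : Role NR) (C : Concept NC NR) :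
      x ∈ T.nodes → Concept.M r R C ∈ T.label x → ¬ T.Blocked x →
      ((T.nbrsWith H R x C).card : ℚ) ≤ r * (T.nbrs H R x).card →
      (T.nbrs H R x).card < T.BAN H x →
      IsSucc y x → y ∉ T.nodes → Gen H T (T.addNode y R C)
  | W_rule (x y : List ℕ) (r : ℚ) (R : Role NR) (C : Concept NC NR) :
      x ∈ T.nodes → Concept.W r R C ∈ T.label x → ¬ T.Blocked x →
      r * (T.nbrs H R x).card < ((T.nbrsWith H R x C.compl).card : ℚ) →
      (T.nbrs H R x).card < T.BAN H x →
      IsSucc y x → y ∉ T.nodes → Gen H T (T.addNode y R C)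

/-- One step of the algorithm: a generating rule is applied only if no non-generating rule is
applicable. -/
def Step (H : Hierarchy NR) (T T' : CTree NC NR) : Prop :=
  NonGen H T T' ∨ ((¬ ∃ T'', NonGen H T T'') ∧ Gen H T T')

/-- `t 0, …, t m` is a run of the algorithm with `m` rule applications, for the concept `D`
(in negation normal form). -/
def IsRun (H : Hierarchy NR) (D : Concept NC NR) (m : ℕ) (t : ℕ → CTree NC NR) : Prop :=
  t 0 = init D ∧ ∀ i < m, Step H (t i) (t (i + 1))

end CTree

end ALCQPIH

namespace ALCQPIH

theorem Role.Inv_Inv {NR : Type v} (R : Role NR) : R.Inv.Inv = R := by cases R <;> rfl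

theorem Role.Inv_ne {NR : Type v} (R : Role NR) : R.Inv ≠ R := by cases R <;> simp [Role.Inv]

namespace Concept

variable {NC : Type u} {NR : Type v}

/-- Negation occurs only in front of concept names. -/
def IsNNF : Concept NC NR → Prop
  | atom _ => True
  | neg C => ∃ a, C = atom a
  | and C D => C.IsNNF ∧ D.IsNNF
  | or C D => C.IsNNF ∧ D.IsNNF
  | all _ C => C.IsNNF
  | ex _ C => C.IsNNF
  | atLeast _ _ C => C.IsNNF
  | atMost _ _ C => C.IsNNF
  | M _ _ C => C.IsNNF
  | W _ _ C => C.IsNNF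

theorem isNNF_nnfAux (C : Concept NC NR) : ∀ b, (nnfAux b C).IsNNF := by
  induction C with
  | atLeast n R C ih =>
    intro b
    cases b
    · cases n <;> simp [nnfAux, IsNNF, ih]
    · simp [nnfAux, IsNNF, ih]
  | _ => intro b; cases b <;> simp [nnfAux, IsNNF, *]

theorem nnfAux_true_of_isNNF {C : Concept NC NR} (h : C.IsNNF) : nnfAux true C = C := by
  induction C with
  | neg C => obtain ⟨a, rfl⟩ := h; simp [nnfAux]
  | and C D ihC ihD => simp [nnfAux, ihC h.1, ihD h.2]
  | or C D ihC ihD => simp [nnfAux, ihC h.1, ihD h.2]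
  | atom => simp [nnfAux]
  | all R C ih => simp [nnfAux, ih h]
  | ex R C ih => simp [nnfAux, ih h]
  | atLeast n R C ih => simp [nnfAux, ih h]
  | atMost n R C ih => simp [nnfAux, ih h]
  | M r R C ih => simp [nnfAux, ih h]
  | W r R C ih => simp [nnfAux, ih h]

theorem compl_atLeast_succ {C : Concept NC NR} (h : C.IsNNF) (n : ℕ) (R : Role NR) :
    (atLeast (n + 1) R C).compl = atMost n R C := by
  simp [compl, nnfAux, nnfAux_true_of_isNNF h]

theorem compl_atLeast_zero (R : Role NR) (C : Concept NC NR) :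
    (atLeast 0 R C).compl = and (atom C.firstName) (neg (atom C.firstName)) := by
  simp [compl, nnfAux]

theorem compl_atMost {C : Concept NC NR} (h : C.IsNNF) (n : ℕ) (R : Role NR) :
    (atMost n R C).compl = atLeast (n + 1) R C := by
  simp [compl, nnfAux, nnfAux_true_of_isNNF h]

@[simp] theorem compl_atom (a : NC) : (atom a : Concept NC NR).compl = neg (atom a) := by
  simp [compl, nnfAux]

@[simp] theorem compl_neg_atom (a : NC) : (neg (atom a) : Concept NC NR).compl = atom a := by
  simp [compl, nnfAux]

@[simp] theorem compl_and (C D : Concept NC NR) : (and C D).compl = or C.compl D.compl := by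
  simp [compl, nnfAux]

@[simp] theorem compl_or (C D : Concept NC NR) : (or C D).compl = and C.compl D.compl := by
  simp [compl, nnfAux]

@[simp] theorem compl_all (R : Role NR) (C : Concept NC NR) : (all R C).compl = ex R C.compl := by
  simp [compl, nnfAux]

@[simp] theorem compl_ex (R : Role NR) (C : Concept NC NR) : (ex R C).compl = all R C.compl := by
  simp [compl, nnfAux]

@[simp] theorem compl_M (r : ℚ) (R : Role NR) (C : Concept NC NR) :
    (M r R C).compl = W r R C.compl := by
  simp [compl, nnfAux]

@[simp] theorem compl_W (r : ℚ) (R : Role NR) (C : Concept NC NR) :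
    (W r R C).compl = M r R C.compl := by
  simp [compl, nnfAux]

theorem compl_compl_compl {C : Concept NC NR} (h : C.IsNNF) :
    C.compl.compl.compl = C.compl := by
  induction C with
  | neg C => obtain ⟨a, rfl⟩ := h; simp
  | and C D ihC ihD => simp [ihC h.1, ihD h.2]
  | or C D ihC ihD => simp [ihC h.1, ihD h.2]
  | atom => simp
  | all R C ih => simp [ih h]
  | ex R C ih => simp [ih h]
  | atLeast n R C ih =>
    cases n with
    | zero => simp [compl_atLeast_zero]
    | succ n =>
      have hC : C.IsNNF := h
      rw [compl_atLeast_succ hC, compl_atMost hC, compl_atLeast_succ hC]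
  | atMost n R C ih =>
    have hC : C.IsNNF := h
    rw [compl_atMost hC, compl_atLeast_succ hC, compl_atMost hC]
  | M r R C ih => simp [ih h]
  | W r R C ih => simp [ih h]

/-- The set of the subconcepts of a concept. -/
noncomputable def subs : Concept NC NR → Finset (Concept NC NR)
  | atom a => {atom a}
  | neg C => insert (neg C) C.subs
  | and C D => insert (and C D) (C.subs ∪ D.subs)
  | or C D => insert (or C D) (C.subs ∪ D.subs)
  | all R C => insert (all R C) C.subs
  | ex R C => insert (ex R C) C.subs
  | atLeast n R C => insert (atLeast n R C) C.subs
  | atMost n R C => insert (atMost n R C) C.subs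
  | M r R C => insert (M r R C) C.subs
  | W r R C => insert (W r R C) C.subs

theorem self_mem_subs (C : Concept NC NR) : C ∈ C.subs := by
  cases C <;> simp [subs]

theorem atom_firstName_mem_subs (C : Concept NC NR) : atom C.firstName ∈ C.subs := by
  induction C <;> simp_all [subs, firstName]

theorem subs_subset {C D : Concept NC NR} (h : C ∈ D.subs) : C.subs ⊆ D.subs := by
  induction D with
  | atom a => simp only [subs, Finset.mem_singleton] at h; rw [h]
  | and A B ihA ihB =>
    simp only [subs, Finset.mem_insert, Finset.mem_union] at h
    rcases h with rfl | h | h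
    · exact subset_rfl
    · exact (ihA h).trans fun x hx => by simp [subs, hx]
    · exact (ihB h).trans fun x hx => by simp [subs, hx]
  | or A B ihA ihB =>
    simp only [subs, Finset.mem_insert, Finset.mem_union] at h
    rcases h with rfl | h | h
    · exact subset_rfl
    · exact (ihA h).trans fun x hx => by simp [subs, hx]
    · exact (ihB h).trans fun x hx => by simp [subs, hx]
  | _ =>
    rename_i ih
    simp only [subs, Finset.mem_insert] at h
    rcases h with rfl | h
    · exact subset_rfl
    · exact (ih h).trans fun x hx => by simp [subs, hx]

theorem isNNF_of_mem_subs {C D : Concept NC NR} (hD : D.IsNNF) (h : C ∈ D.subs) : C.IsNNF := by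
  induction D with
  | atom a => simp only [subs, Finset.mem_singleton] at h; rw [h]; trivial
  | neg A =>
    obtain ⟨a, rfl⟩ := hD
    simp only [subs, Finset.mem_insert, Finset.mem_singleton] at h
    rcases h with rfl | rfl
    · exact ⟨a, rfl⟩
    · trivial
  | and A B ihA ihB =>
    simp only [subs, Finset.mem_insert, Finset.mem_union] at h
    rcases h with rfl | h | h
    · exact hD
    · exact ihA hD.1 h
    · exact ihB hD.2 h
  | or A B ihA ihB =>
    simp only [subs, Finset.mem_insert, Finset.mem_union] at h
    rcases h with rfl | h | h
    · exact hD
    · exact ihA hD.1 h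
    · exact ihB hD.2 h
  | _ =>
    rename_i ih
    simp only [subs, Finset.mem_insert] at h
    rcases h with rfl | h
    · exact hD
    · exact ih hD h

theorem occRoles_subset {C D : Concept NC NR} (h : C ∈ D.subs) : C.occRoles ⊆ D.occRoles := by
  induction D with
  | atom a => simp only [subs, Finset.mem_singleton] at h; rw [h]
  | and A B ihA ihB =>
    simp only [subs, Finset.mem_insert, Finset.mem_union] at h
    rcases h with rfl | h | h
    · exact subset_rfl
    · exact (ihA h).trans fun x hx => by simp [occRoles, hx]
    · exact (ihB h).trans fun x hx => by simp [occRoles, hx]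
  | or A B ihA ihB =>
    simp only [subs, Finset.mem_insert, Finset.mem_union] at h
    rcases h with rfl | h | h
    · exact subset_rfl
    · exact (ihA h).trans fun x hx => by simp [occRoles, hx]
    · exact (ihB h).trans fun x hx => by simp [occRoles, hx]
  | _ =>
    rename_i ih
    simp only [subs, Finset.mem_insert] at h
    rcases h with rfl | h
    · exact subset_rfl
    · exact (ih h).trans fun x hx => by simp [occRoles, hx]

/-- The number of symbols at the uppermost level of a concept. -/
def headLength : Concept NC NR → ℕ
  | atom _ => 1
  | neg _ => 1
  | and _ _ => 1
  | or _ _ => 1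
  | all _ _ => 2
  | ex _ _ => 2
  | atLeast n _ _ => 2 + numLength n
  | atMost n _ _ => 2 + numLength n
  | M r _ _ => 2 + numLength r.num.natAbs + numLength r.den
  | W r _ _ => 2 + numLength r.num.natAbs + numLength r.den

theorem sum_union_le_add {α : Type*} (f : α → ℕ) (s t : Finset α) :
    ∑ a ∈ s ∪ t, f a ≤ ∑ a ∈ s, f a + ∑ a ∈ t, f a := by
  rw [← Finset.sum_union_inter]; exact Nat.le_add_right _ _

theorem sum_insert_le_add {α : Type*} (f : α → ℕ) (a : α) (s : Finset α) :
    ∑ b ∈ insert a s, f b ≤ f a + ∑ b ∈ s, f b := by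
  by_cases h : a ∈ s
  · rw [Finset.insert_eq_of_mem h]; exact Nat.le_add_left _ _
  · rw [Finset.sum_insert h]

theorem sum_image_le_sum {α β : Type*} (f : β → ℕ) (g : α → β) (s : Finset α) :
    ∑ b ∈ s.image g, f b ≤ ∑ a ∈ s, f (g a) := by
  induction s using Finset.induction_on with
  | empty => simp
  | insert a s ha ih =>
    rw [Finset.image_insert, Finset.sum_insert ha]
    exact (sum_insert_le_add f _ _).trans (Nat.add_le_add_left ih _)

theorem sum_headLength_subs_le (C : Concept NC NR) :
    ∑ E ∈ C.subs, E.headLength ≤ C.length := by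
  induction C with
  | atom a => simp [subs, headLength, length]
  | and A B ihA ihB =>
    have h := sum_insert_le_add headLength (and A B) (A.subs ∪ B.subs)
    have h1 : headLength (and A B) = 1 := rfl
    have h' := sum_union_le_add headLength A.subs B.subs
    simp only [subs, length]
    omega
  | or A B ihA ihB =>
    have h := sum_insert_le_add headLength (or A B) (A.subs ∪ B.subs)
    have h1 : headLength (or A B) = 1 := rfl
    have h' := sum_union_le_add headLength A.subs B.subs
    simp only [subs, length]
    omega
  | _ =>
    rename_i ih
    simp only [subs, length]
    refine (sum_insert_le_add _ _ _).trans ((Nat.add_le_add_left ih _).trans ?_)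
    simp only [headLength]
    omega

theorem headLength_le_of_mem_subs {C D : Concept NC NR} (h : C ∈ D.subs) :
    C.headLength ≤ D.length :=
  (Finset.single_le_sum (f := headLength) (fun _ _ => Nat.zero_le _) h).trans
    (sum_headLength_subs_le D)

/-- `1` for a concept `∀ R.C` or `∃ R.C`, and `0` for other concepts. -/
def isQuant : Concept NC NR → ℕ
  | all _ _ => 1
  | ex _ _ => 1
  | _ => 0

/-- The number of the subconcepts `∀ R.C` and `∃ R.C` of a concept. -/
noncomputable def numQuant (D : Concept NC NR) : ℕ := ∑ E ∈ D.subs, E.isQuant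

theorem card_subs_add_numQuant_le (D : Concept NC NR) : D.subs.card + D.numQuant ≤ D.length := by
  refine le_trans ?_ (sum_headLength_subs_le D)
  rw [numQuant, Finset.card_eq_sum_ones, ← Finset.sum_add_distrib]
  refine Finset.sum_le_sum fun E _ => ?_
  cases E <;> simp only [isQuant, headLength] <;> omega

theorem two_mul_numQuant_lt (D : Concept NC NR) : 2 * D.numQuant + 1 ≤ D.length := by
  refine le_trans ?_ (sum_headLength_subs_le D)
  have hmem := atom_firstName_mem_subs D
  rw [numQuant, Finset.mul_sum, ← Finset.add_sum_erase _ _ hmem, ← Finset.add_sum_erase _ _ hmem]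
  have : ∑ E ∈ D.subs.erase (atom D.firstName), 2 * E.isQuant ≤
      ∑ E ∈ D.subs.erase (atom D.firstName), E.headLength :=
    Finset.sum_le_sum fun E _ => by cases E <;> simp only [isQuant, headLength] <;> omega
  have h1 : isQuant (atom D.firstName : Concept NC NR) = 0 := rfl
  have h2 : headLength (atom D.firstName : Concept NC NR) = 1 := rfl
  omega

/-- The concepts `E` for which `∀ R.E` arises from a concept by repeated complementation. -/
noncomputable def quantBodies : Concept NC NR → Finset (Concept NC NR)
  | all _ C => {C, C.compl.compl}
  | ex _ C => {C.compl}
  | _ => ∅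

theorem card_quantBodies_le (C : Concept NC NR) : C.quantBodies.card ≤ 2 * C.isQuant := by
  cases C <;> simp only [quantBodies, isQuant, Finset.card_empty, Finset.card_singleton] <;>
    first | omega | exact Finset.card_le_two

/-- The subconcepts, their complements, and the complements of those. -/
noncomputable def complSubs (D : Concept NC NR) : Finset (Concept NC NR) :=
  D.subs ∪ (D.subs.image compl ∪ D.subs.image fun E => E.compl.compl)

/-- A set that contains all the concepts which the algorithm adds to the labels. -/
noncomputable def closure (D : Concept NC NR) (H : Hierarchy NR) : Finset (Concept NC NR) :=
  D.complSubs ∪ ((D.rolesWith H) ×ˢ D.subs.biUnion quantBodies).image fun p => all p.1 p.2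

theorem mem_complSubs {C D : Concept NC NR} :
    C ∈ D.complSubs ↔ ∃ E ∈ D.subs, C = E ∨ C = E.compl ∨ C = E.compl.compl := by
  simp only [complSubs, Finset.mem_union, Finset.mem_image]
  constructor
  · rintro (h | ⟨E, h, rfl⟩ | ⟨E, h, rfl⟩)
    · exact ⟨C, h, Or.inl rfl⟩
    · exact ⟨E, h, Or.inr (Or.inl rfl)⟩
    · exact ⟨E, h, Or.inr (Or.inr rfl)⟩
  · rintro ⟨E, h, rfl | rfl | rfl⟩
    · exact Or.inl h
    · exact Or.inr (Or.inl ⟨E, h, rfl⟩)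
    · exact Or.inr (Or.inr ⟨E, h, rfl⟩)

theorem card_closure_le (D : Concept NC NR) (H : Hierarchy NR) :
    (D.closure H).card ≤ 3 * D.subs.card + (D.rolesWith H).card * (2 * D.numQuant) := by
  have h1 : (D.closure H).card ≤ D.complSubs.card +
      (((D.rolesWith H) ×ˢ D.subs.biUnion quantBodies).image fun p => all p.1 p.2).card :=
    Finset.card_union_le _ _
  have h2 : D.complSubs.card ≤ D.subs.card + (D.subs.card + D.subs.card) :=
    (Finset.card_union_le _ _).trans (Nat.add_le_add_left ((Finset.card_union_le _ _).trans
      (Nat.add_le_add Finset.card_image_le Finset.card_image_le)) _)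
  have h3 : (((D.rolesWith H) ×ˢ D.subs.biUnion quantBodies).image
      fun p => all p.1 p.2).card ≤ (D.rolesWith H).card * (2 * D.numQuant) := by
    refine Finset.card_image_le.trans ?_
    rw [Finset.card_product, numQuant, Finset.mul_sum]
    exact Nat.mul_le_mul_left _ (Finset.card_biUnion_le.trans
      (Finset.sum_le_sum fun E _ => card_quantBodies_le E))
  omega

theorem sum_closure_le (D : Concept NC NR) (H : Hierarchy NR) (f : Concept NC NR → ℕ)
    (hf : ∀ R C, f (all R C) = 0) :
    ∑ C ∈ D.closure H, f C ≤ ∑ E ∈ D.subs, (f E + (f E.compl + f E.compl.compl)) := by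
  have h0 : ∑ C ∈ ((D.rolesWith H) ×ˢ D.subs.biUnion quantBodies).image
      (fun p => all p.1 p.2), f C = 0 := by
    refine Finset.sum_eq_zero fun C hC => ?_
    obtain ⟨p, -, rfl⟩ := Finset.mem_image.1 hC
    exact hf _ _
  refine (sum_union_le_add _ _ _).trans ?_
  rw [h0, add_zero, Finset.sum_add_distrib, Finset.sum_add_distrib]
  exact (sum_union_le_add _ _ _).trans (Nat.add_le_add_left ((sum_union_le_add _ _ _).trans
    (Nat.add_le_add (sum_image_le_sum _ _ _) (sum_image_le_sum _ _ _))) _)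

theorem self_mem_closure (D : Concept NC NR) (H : Hierarchy NR) : D ∈ D.closure H :=
  Finset.mem_union_left _ (mem_complSubs.2 ⟨D, self_mem_subs D, Or.inl rfl⟩)

/-- The immediate constituents of a concept: the operands of `⊓` and `⊔`, and `C` in `∀ R.C` and
in `⊠ R.C`. -/
noncomputable def parts : Concept NC NR → Finset (Concept NC NR)
  | and C D => {C, D}
  | or C D => {C, D}
  | all _ C => {C}
  | ex _ C => {C}
  | atLeast _ _ C => {C}
  | atMost _ _ C => {C}
  | M _ _ C => {C}
  | W _ _ C => {C}
  | _ => ∅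

theorem parts_subset_subs (E : Concept NC NR) : E.parts ⊆ E.subs := by
  intro X hX
  cases E <;> simp only [parts, subs, Finset.mem_insert, Finset.mem_singleton, Finset.notMem_empty,
    Finset.mem_union] at hX ⊢
  all_goals first
    | exact Or.inr (hX ▸ self_mem_subs _)
    | (rcases hX with rfl | rfl
       · exact Or.inr (Or.inl (self_mem_subs _))
       · exact Or.inr (Or.inr (self_mem_subs _)))

theorem mem_parts_compl {E X : Concept NC NR} (hE : E.IsNNF) (hX : X ∈ E.compl.parts) :
    ∃ F ∈ E.subs, X = F ∨ X = F.compl := by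
  cases E with
  | atom a => simp [parts] at hX
  | neg A => obtain ⟨a, rfl⟩ := hE; simp [parts] at hX
  | and A B =>
    simp only [compl_and, parts, Finset.mem_insert, Finset.mem_singleton] at hX
    rcases hX with rfl | rfl
    · exact ⟨A, by simp [subs, self_mem_subs], Or.inr rfl⟩
    · exact ⟨B, by simp [subs, self_mem_subs], Or.inr rfl⟩
  | or A B =>
    simp only [compl_or, parts, Finset.mem_insert, Finset.mem_singleton] at hX
    rcases hX with rfl | rfl
    · exact ⟨A, by simp [subs, self_mem_subs], Or.inr rfl⟩
    · exact ⟨B, by simp [subs, self_mem_subs], Or.inr rfl⟩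
  | atLeast n R C =>
    cases n with
    | zero =>
      simp only [compl_atLeast_zero, parts, Finset.mem_insert, Finset.mem_singleton] at hX
      refine ⟨atom C.firstName, by simp [subs, atom_firstName_mem_subs], ?_⟩
      simpa using hX
    | succ n =>
      simp only [compl_atLeast_succ (show C.IsNNF from hE), parts, Finset.mem_singleton] at hX
      exact ⟨C, by simp [subs, self_mem_subs], Or.inl hX⟩
  | atMost n R C =>
    simp only [compl_atMost (show C.IsNNF from hE), parts, Finset.mem_singleton] at hX
    exact ⟨C, by simp [subs, self_mem_subs], Or.inl hX⟩
  | all R C | ex R C | M r R C | W r R C =>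
    simp only [compl_all, compl_ex, compl_M, compl_W, parts, Finset.mem_singleton] at hX
    exact ⟨C, by simp [subs, self_mem_subs], Or.inr hX⟩

theorem mem_parts_compl_compl {E X : Concept NC NR} (hE : E.IsNNF)
    (hX : X ∈ E.compl.compl.parts) :
    ∃ F ∈ E.subs, X = F ∨ X = F.compl ∨ X = F.compl.compl := by
  cases E with
  | atom a => simp [parts] at hX
  | neg A => obtain ⟨a, rfl⟩ := hE; simp [parts] at hX
  | and A B =>
    simp only [compl_and, compl_or, parts, Finset.mem_insert, Finset.mem_singleton] at hX
    rcases hX with rfl | rfl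
    · exact ⟨A, by simp [subs, self_mem_subs], Or.inr (Or.inr rfl)⟩
    · exact ⟨B, by simp [subs, self_mem_subs], Or.inr (Or.inr rfl)⟩
  | or A B =>
    simp only [compl_or, compl_and, parts, Finset.mem_insert, Finset.mem_singleton] at hX
    rcases hX with rfl | rfl
    · exact ⟨A, by simp [subs, self_mem_subs], Or.inr (Or.inr rfl)⟩
    · exact ⟨B, by simp [subs, self_mem_subs], Or.inr (Or.inr rfl)⟩
  | atLeast n R C =>
    cases n with
    | zero =>
      simp only [compl_atLeast_zero, compl_and, compl_atom, compl_neg_atom, parts,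
        Finset.mem_insert, Finset.mem_singleton] at hX
      refine ⟨atom C.firstName, by simp [subs, atom_firstName_mem_subs], ?_⟩
      simp only [compl_atom]
      tauto
    | succ n =>
      simp only [compl_atLeast_succ (show C.IsNNF from hE), compl_atMost (show C.IsNNF from hE),
        parts, Finset.mem_singleton] at hX
      exact ⟨C, by simp [subs, self_mem_subs], Or.inl hX⟩
  | atMost n R C =>
    simp only [compl_atLeast_succ (show C.IsNNF from hE), compl_atMost (show C.IsNNF from hE),
      parts, Finset.mem_singleton] at hX
    exact ⟨C, by simp [subs, self_mem_subs], Or.inl hX⟩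
  | all R C | ex R C | M r R C | W r R C =>
    simp only [compl_all, compl_ex, compl_M, compl_W, parts, Finset.mem_singleton] at hX
    exact ⟨C, by simp [subs, self_mem_subs], Or.inr (Or.inr hX)⟩

theorem parts_subset_complSubs {D C : Concept NC NR} (hD : D.IsNNF) (hC : C ∈ D.complSubs) :
    C.parts ⊆ D.complSubs := by
  intro X hX
  obtain ⟨E, hE, rfl | rfl | rfl⟩ := mem_complSubs.1 hC
  · exact mem_complSubs.2 ⟨X, subs_subset hE (parts_subset_subs _ hX), Or.inl rfl⟩
  · obtain ⟨F, hF, h⟩ := mem_parts_compl (isNNF_of_mem_subs hD hE) hX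
    exact mem_complSubs.2 ⟨F, subs_subset hE hF, by tauto⟩
  · obtain ⟨F, hF, h⟩ := mem_parts_compl_compl (isNNF_of_mem_subs hD hE) hX
    exact mem_complSubs.2 ⟨F, subs_subset hE hF, h⟩

theorem quantBodies_subset_complSubs {D E : Concept NC NR} (hE : E ∈ D.subs) :
    E.quantBodies ⊆ D.complSubs := by
  intro X hX
  cases E with
  | all R C =>
    have hC : C ∈ D.subs := subs_subset hE (by simp [subs, self_mem_subs])
    simp only [quantBodies, Finset.mem_insert, Finset.mem_singleton] at hX
    exact mem_complSubs.2 ⟨C, hC, by tauto⟩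
  | ex R C =>
    have hC : C ∈ D.subs := subs_subset hE (by simp [subs, self_mem_subs])
    simp only [quantBodies, Finset.mem_singleton] at hX
    exact mem_complSubs.2 ⟨C, hC, by tauto⟩
  | _ => simp [quantBodies] at hX

theorem parts_subset_closure {D C : Concept NC NR} {H : Hierarchy NR} (hD : D.IsNNF)
    (hC : C ∈ D.closure H) : C.parts ⊆ D.closure H := by
  rcases Finset.mem_union.1 hC with hC | hC
  · exact (parts_subset_complSubs hD hC).trans Finset.subset_union_left
  · obtain ⟨⟨R, B⟩, hp, rfl⟩ := Finset.mem_image.1 hC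
    obtain ⟨E, hE, hB⟩ := Finset.mem_biUnion.1 (Finset.mem_product.1 hp).2
    intro X hX
    rw [show X = B by simpa [parts] using hX]
    exact Finset.mem_union_left _ (quantBodies_subset_complSubs hE hB)

theorem compl_mem_complSubs {D C : Concept NC NR} (hD : D.IsNNF) (hC : C ∈ D.complSubs) :
    C.compl ∈ D.complSubs := by
  obtain ⟨E, hE, rfl | rfl | rfl⟩ := mem_complSubs.1 hC
  · exact mem_complSubs.2 ⟨C, hE, by tauto⟩
  · exact mem_complSubs.2 ⟨E, hE, by tauto⟩
  · exact mem_complSubs.2 ⟨E, hE, by rw [compl_compl_compl (isNNF_of_mem_subs hD hE)]; tauto⟩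

theorem box_mem_parts {B C : Concept NC NR} {R : Role NR} (h : B.box = some (R, C)) :
    C ∈ B.parts := by
  cases B <;> simp_all [box, parts]

theorem mem_complSubs_of_box {D B C : Concept NC NR} {H : Hierarchy NR} {R : Role NR}
    (hB : B ∈ D.closure H) (h : B.box = some (R, C)) : B ∈ D.complSubs := by
  rcases Finset.mem_union.1 hB with hB | hB
  · exact hB
  · obtain ⟨p, -, rfl⟩ := Finset.mem_image.1 hB
    simp [box] at h

theorem compl_mem_closure_of_box {D B C : Concept NC NR} {H : Hierarchy NR} {R : Role NR}
    (hD : D.IsNNF) (hB : B ∈ D.closure H) (h : B.box = some (R, C)) :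
    C.compl ∈ D.closure H :=
  Finset.mem_union_left _ (compl_mem_complSubs hD
    (parts_subset_complSubs hD (mem_complSubs_of_box hB h) (box_mem_parts h)))

theorem occRoles_compl {E : Concept NC NR} (hE : E.IsNNF) :
    E.compl.occRoles ⊆ E.occRoles := by
  induction E with
  | atom a => simp [occRoles]
  | neg A => obtain ⟨a, rfl⟩ := hE; simp [occRoles]
  | and A B ihA ihB =>
    simpa [occRoles] using Finset.union_subset_union (ihA hE.1) (ihB hE.2)
  | or A B ihA ihB =>
    simpa [occRoles] using Finset.union_subset_union (ihA hE.1) (ihB hE.2)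
  | atLeast n R C ih =>
    cases n with
    | zero => simp [compl_atLeast_zero, occRoles]
    | succ n => rw [compl_atLeast_succ (show C.IsNNF from hE)]; simp [occRoles]
  | atMost n R C ih => rw [compl_atMost (show C.IsNNF from hE)]; simp [occRoles]
  | all R C ih | ex R C ih | M r R C ih | W r R C ih =>
    simpa [occRoles] using Finset.insert_subset_insert R (ih hE)

theorem occRoles_subset_of_mem_complSubs {D C : Concept NC NR} (hD : D.IsNNF)
    (hC : C ∈ D.complSubs) : C.occRoles ⊆ D.occRoles := by
  obtain ⟨E, hE, rfl | rfl | rfl⟩ := mem_complSubs.1 hC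
  · exact occRoles_subset hE
  · exact (occRoles_compl (isNNF_of_mem_subs hD hE)).trans (occRoles_subset hE)
  · exact ((occRoles_compl (isNNF_nnfAux _ _)).trans
      (occRoles_compl (isNNF_of_mem_subs hD hE))).trans (occRoles_subset hE)

theorem box_role_mem {D B C : Concept NC NR} {H : Hierarchy NR} {R : Role NR}
    (hD : D.IsNNF) (hB : B ∈ D.closure H) (h : B.box = some (R, C)) : R ∈ D.rolesWith H := by
  refine Finset.mem_union_left _ (Finset.mem_union_left _
    (occRoles_subset_of_mem_complSubs hD (mem_complSubs_of_box hB h) ?_))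
  cases B <;> simp_all [box, occRoles]

theorem mem_roles_of_sub {H : Hierarchy NR} {R S : Role NR} (h : H.Sub R S) (hne : R ≠ S) :
    R ∈ H.roles := by
  rcases Relation.ReflTransGen.cases_head h with rfl | ⟨P, hRP | hRP, -⟩
  · exact absurd rfl hne
  · exact Finset.mem_union_left _ (Finset.mem_union_left _ (Finset.mem_image.2 ⟨_, hRP, rfl⟩))
  · exact Finset.mem_union_right _ (Finset.mem_image.2 ⟨R.Inv,
      Finset.mem_union_left _ (Finset.mem_image.2 ⟨_, hRP, rfl⟩), R.Inv_Inv⟩)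

theorem mem_biUnion_quantBodies {D C : Concept NC NR} {S : Role NR} (hD : D.IsNNF)
    (h : all S C ∈ D.complSubs) : C ∈ D.subs.biUnion quantBodies := by
  obtain ⟨E, hE, h⟩ := mem_complSubs.1 h
  refine Finset.mem_biUnion.2 ⟨E, hE, ?_⟩
  have hN := isNNF_of_mem_subs hD hE
  cases E with
  | neg A => obtain ⟨a, rfl⟩ := hN; simp at h
  | atLeast n R C =>
    cases n with
    | zero => simp [compl_atLeast_zero] at h
    | succ n =>
      rw [compl_atLeast_succ (show C.IsNNF from hN), compl_atMost (show C.IsNNF from hN)] at h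
      simp at h
  | atMost n R C =>
    rw [compl_atMost (show C.IsNNF from hN), compl_atLeast_succ (show C.IsNNF from hN)] at h
    simp at h
  | all R B => simp at h; simp [quantBodies]; tauto
  | ex R B => simp at h; simp [quantBodies]; tauto
  | _ => simp at h

theorem all_mem_closure_of_sub {D C : Concept NC NR} {H : Hierarchy NR} {R S : Role NR}
    (hD : D.IsNNF) (h : all S C ∈ D.closure H) (hRS : H.Sub R S) : all R C ∈ D.closure H := by
  by_cases hne : R = S
  · rwa [hne]
  · have hR : R ∈ D.rolesWith H := Finset.mem_union_right _ (mem_roles_of_sub hRS hne)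
    refine Finset.mem_union_right _ (Finset.mem_image.2 ⟨(R, C), Finset.mem_product.2 ⟨hR, ?_⟩, rfl⟩)
    rcases Finset.mem_union.1 h with h | h
    · exact mem_biUnion_quantBodies hD h
    · obtain ⟨p, hp, he⟩ := Finset.mem_image.1 h
      obtain ⟨-, rfl⟩ : p.1 = S ∧ p.2 = C := by simpa using he
      exact (Finset.mem_product.1 hp).2

theorem Inv_mem_rolesWith {D : Concept NC NR} {H : Hierarchy NR} {R : Role NR}
    (h : R ∈ D.rolesWith H) : R.Inv ∈ D.rolesWith H := by
  simp only [rolesWith, Hierarchy.roles, Finset.mem_union, Finset.mem_image] at h ⊢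
  rcases h with (h | ⟨S, h, rfl⟩) | h | ⟨S, h, rfl⟩
  · exact Or.inl (Or.inr ⟨R, h, rfl⟩)
  · exact Or.inl (Or.inl (by rwa [Role.Inv_Inv]))
  · exact Or.inr (Or.inr ⟨R, h, rfl⟩)
  · exact Or.inr (Or.inl (by rwa [Role.Inv_Inv]))

theorem two_le_card_rolesWith {D : Concept NC NR} {H : Hierarchy NR} {R : Role NR}
    (h : R ∈ D.rolesWith H) : 2 ≤ (D.rolesWith H).card :=
  Finset.one_lt_card.2 ⟨R.Inv, Inv_mem_rolesWith h, R, h, R.Inv_ne⟩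

theorem supers_subset_rolesWith {D : Concept NC NR} {H : Hierarchy NR} {R : Role NR}
    (h : R ∈ D.rolesWith H) : H.supers R ⊆ D.rolesWith H :=
  Finset.insert_subset h ((Finset.filter_subset _ _).trans Finset.subset_union_right)

end Concept

end ALCQPIH

namespace ALCQPIH

variable {NC : Type u} {NR : Type v}

namespace Concept

/-- One more than the length of the denominator of the index of a part restriction, and `0` for
other concepts. -/
def partWeight : Concept NC NR → ℕ
  | M r _ _ => 1 + numLength r.den
  | W r _ _ => 1 + numLength r.den
  | _ => 0

theorem lt_two_pow_numLength (n : ℕ) : n < 2 ^ numLength n :=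
  (Nat.lt_size_self n).trans_le (Nat.pow_le_pow_right (by norm_num) (le_max_right _ _))

theorem two_mul_den_rbar_le {C : Concept NC NR} (h : C.partRole.isSome) :
    2 * C.rbar.den ≤ 2 ^ C.partWeight := by
  cases C with
  | M r R C =>
    simp only [rbar, partWeight, pow_add, pow_one]
    exact Nat.mul_le_mul_left _ (lt_two_pow_numLength _).le
  | W r R C =>
    simp only [rbar, partWeight, pow_add, pow_one]
    refine Nat.mul_le_mul_left _ (le_trans ?_ (lt_two_pow_numLength _).le)
    have := Rat.sub_den_dvd 1 r
    simp only [Rat.den_one, one_mul] at this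
    exact Nat.le_of_dvd r.den_pos this
  | _ => simp [partRole] at h

theorem one_le_partWeight {C : Concept NC NR} (h : C.partRole.isSome) : 1 ≤ C.partWeight := by
  cases C <;> simp_all [partRole, partWeight]

theorem den_wIndex_le (C : Concept NC NR) : (C.wIndex.getD 0).den ≤ 2 ^ C.partWeight := by
  cases C with
  | W r R C =>
    simp only [wIndex, partWeight, pow_add, pow_one, Option.getD_some]
    have := lt_two_pow_numLength r.den
    omega
  | _ => simpa [wIndex] using Nat.one_le_two_pow

end Concept

theorem den_sum_dvd {α : Type*} (K : Finset α) (f : α → ℚ) :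
    (∑ a ∈ K, f a).den ∣ ∏ a ∈ K, (f a).den := by
  induction K using Finset.induction_on with
  | empty => simp
  | insert a K ha ih =>
    rw [Finset.sum_insert ha, Finset.prod_insert ha]
    exact (Rat.add_den_dvd _ _).trans (mul_dvd_mul_left _ ih)

theorem floor_div_le_mul_den (B : ℕ) {x : ℚ} (hx : 0 < x) : ⌊(B : ℚ) / x⌋₊ ≤ B * x.den := by
  refine Nat.floor_le_of_le ?_
  rw [div_le_iff₀ hx]
  push_cast
  rw [mul_assoc, mul_comm _ x, Rat.mul_den_eq_num]
  have h1 : (1 : ℚ) ≤ (x.num : ℚ) := by exact_mod_cast Rat.num_pos.2 hx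
  exact le_mul_of_one_le_right (Nat.cast_nonneg _) h1

theorem clusterNum_le {Cl : Finset (Concept NC NR)} (hCl : ∀ C ∈ Cl, C.partRole.isSome)
    {B Z : ℕ} (hB : B ≤ Z) (hZ : 1 ≤ Z) :
    clusterNum Cl B ≤ Z * 2 ^ ∑ C ∈ Cl, C.partWeight := by
  unfold clusterNum
  split_ifs with h
  · refine Finset.sup_le fun K hK => ?_
    obtain ⟨hKCl, -, hlt⟩ := Finset.mem_filter.1 hK
    rw [Finset.mem_powerset] at hKCl
    have hx : 0 < 1 - ∑ C ∈ K, C.rbar := sub_pos.2 hlt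
    have hden : (1 - ∑ C ∈ K, C.rbar).den ≤ ∏ C ∈ K, C.rbar.den := by
      refine Nat.le_of_dvd (Finset.prod_pos fun C _ => C.rbar.den_pos) ?_
      have := Rat.sub_den_dvd 1 (∑ C ∈ K, C.rbar)
      simp only [Rat.den_one, one_mul] at this
      exact this.trans (den_sum_dvd _ _)
    have hprod : 2 ^ K.card * ∏ C ∈ K, C.rbar.den ≤ 2 ^ ∑ C ∈ Cl, C.partWeight := by
      rw [← Finset.prod_const, ← Finset.prod_mul_distrib]
      refine le_trans (Finset.prod_le_prod' fun C hC => C.two_mul_den_rbar_le (hCl C (hKCl hC))) ?_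
      rw [Finset.prod_pow_eq_pow_sum]
      exact Nat.pow_le_pow_right (by norm_num) (Finset.sum_le_sum_of_subset hKCl)
    have hcard : K.card + 1 ≤ 2 ^ K.card := K.card.lt_two_pow_self
    have hpos : 0 < ∏ C ∈ K, C.rbar.den := Finset.prod_pos fun C _ => C.rbar.den_pos
    calc ⌊(B : ℚ) / (1 - ∑ C ∈ K, C.rbar)⌋₊ + K.card
        ≤ B * (1 - ∑ C ∈ K, C.rbar).den + K.card :=
          Nat.add_le_add_right (floor_div_le_mul_den B hx) _
      _ ≤ Z * ∏ C ∈ K, C.rbar.den + Z * (K.card * ∏ C ∈ K, C.rbar.den) :=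
          Nat.add_le_add (Nat.mul_le_mul hB hden)
            ((Nat.le_mul_of_pos_right _ hpos).trans (Nat.le_mul_of_pos_left _ hZ))
      _ = Z * ((K.card + 1) * ∏ C ∈ K, C.rbar.den) := by ring
      _ ≤ Z * (2 ^ K.card * ∏ C ∈ K, C.rbar.den) :=
          Nat.mul_le_mul_left _ (Nat.mul_le_mul_right _ hcard)
      _ ≤ _ := Nat.mul_le_mul_left _ hprod
  · exact Nat.mul_pos hZ (Nat.two_pow_pos _)

/-- For a strict order, the sum of `q a * ∏ b < a, (1 + q b)` is at most `∏ a, (1 + q a)`. -/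
theorem sum_mul_prod_filter_le {α : Type*} (r : α → α → Prop) (hirr : ∀ a, ¬ r a a)
    (htrans : ∀ a b c, r a b → r b c → r a c) (q : α → ℕ) (Y : Finset α) :
    ∑ a ∈ Y, q a * ∏ b ∈ Y.filter (fun b => r b a), (1 + q b) ≤ ∏ a ∈ Y, (1 + q a) := by
  induction hn : Y.card generalizing Y with
  | zero => simp [Finset.card_eq_zero.1 hn]
  | succ n ih =>
    have hne : Y.Nonempty := Finset.card_pos.1 (by omega)
    obtain ⟨m, hm, hmax⟩ : ∃ m ∈ Y, ∀ a ∈ Y, ¬ r m a := by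
      obtain ⟨m, hm, hmin⟩ := Finset.exists_min_image Y (fun a => (Y.filter fun b => r a b).card) hne
      refine ⟨m, hm, fun a ha hma => ?_⟩
      refine absurd (hmin a ha) (not_le.2 (Finset.card_lt_card ⟨fun b hb => ?_, fun h => ?_⟩))
      · obtain ⟨h1, h2⟩ := Finset.mem_filter.1 hb
        exact Finset.mem_filter.2 ⟨h1, htrans _ _ _ hma h2⟩
      · exact hirr a (Finset.mem_filter.1 (h (Finset.mem_filter.2 ⟨ha, hma⟩))).2
    rw [← Finset.add_sum_erase _ _ hm, ← Finset.mul_prod_erase _ _ hm]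
    have hfil : ∀ a ∈ Y, Y.filter (fun b => r b a) = (Y.erase m).filter (fun b => r b a) := by
      intro a ha
      ext b
      simp only [Finset.mem_filter, Finset.mem_erase]
      refine ⟨fun ⟨hb, hba⟩ => ⟨⟨?_, hb⟩, hba⟩, fun ⟨⟨_, hb⟩, hba⟩ => ⟨hb, hba⟩⟩
      rintro rfl
      exact hmax a ha hba
    have h1 : ∑ a ∈ Y.erase m, q a * ∏ b ∈ Y.filter (fun b => r b a), (1 + q b) ≤
        ∏ a ∈ Y.erase m, (1 + q a) := by
      refine le_trans (le_of_eq (Finset.sum_congr rfl fun a ha => ?_))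
        (ih (Y.erase m) (by rw [Finset.card_erase_of_mem hm]; omega))
      rw [hfil a (Finset.mem_of_mem_erase ha)]
    have h2 : ∏ b ∈ Y.filter (fun b => r b m), (1 + q b) ≤ ∏ a ∈ Y.erase m, (1 + q a) := by
      rw [hfil m hm]
      exact Finset.prod_le_prod_of_subset_of_one_le' (Finset.filter_subset _ _)
        fun _ _ _ => Nat.le_add_right _ _
    have h3 := Nat.mul_le_mul_left (q m) h2
    rw [add_mul, one_mul]
    omega

/-- The factor by which the base number of `R` grows in the satisfaction number of `R`. -/
noncomputable def growth (L : Finset (Concept NC NR)) (R : Role NR) : ℕ :=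
  2 ^ ∑ C ∈ cluster L R, C.partWeight

theorem isSome_partRole_of_mem_cluster {L : Finset (Concept NC NR)} {R : Role NR}
    {C : Concept NC NR} (h : C ∈ cluster L R) : C.partRole.isSome := by
  rw [(Finset.mem_filter.1 h).2]; rfl

theorem satNum_le (H : Hierarchy NR) (L : Finset (Concept NC NR)) {nbar X : ℕ} (hX : 1 ≤ X)
    (hn : nbar ≤ X) (R : Role NR) :
    satNum H L nbar R ≤ X * (growth L R *
      ∏ S ∈ (partRoles L).filter (fun S => H.SSub S R), (1 + growth L S)) := by
  induction hd : ((partRoles L).filter fun P => H.SSub P R).card using Nat.strong_induction_on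
    generalizing R with
  | _ d ih =>
    subst hd
    have hprod : 1 ≤ ∏ S ∈ (partRoles L).filter (fun S => H.SSub S R), (1 + growth L S) :=
      Finset.one_le_prod' fun _ _ => Nat.le_add_right _ _
    rw [mul_comm (growth L R), ← mul_assoc, satNum]
    refine clusterNum_le (fun C hC => isSome_partRole_of_mem_cluster hC) ?_ (Nat.mul_pos hX hprod)
    split_ifs with h
    · exact hn.trans (Nat.le_mul_of_pos_right _ hprod)
    · rw [Finset.sum_attach (directSubs H L R) (satNum H L nbar)]
      have hsub : directSubs H L R ⊆ (partRoles L).filter (fun S => H.SSub S R) := by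
        intro S hS
        obtain ⟨h1, h2, -⟩ := Finset.mem_filter.1 hS
        exact Finset.mem_filter.2 ⟨h1, h2⟩
      calc ∑ S ∈ directSubs H L R, satNum H L nbar S
          ≤ ∑ S ∈ directSubs H L R, X * (growth L S *
              ∏ P ∈ (partRoles L).filter (fun P => H.SSub P S), (1 + growth L P)) :=
            Finset.sum_le_sum fun S hS => ih _ (card_lt_of_mem_directSubs hS) S rfl
        _ ≤ ∑ S ∈ (partRoles L).filter (fun S => H.SSub S R), X * (growth L S *
              ∏ P ∈ (partRoles L).filter (fun P => H.SSub P S), (1 + growth L P)) :=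
            Finset.sum_le_sum_of_subset hsub
        _ = X * ∑ S ∈ (partRoles L).filter (fun S => H.SSub S R), growth L S *
              ∏ P ∈ ((partRoles L).filter (fun S => H.SSub S R)).filter (fun P => H.SSub P S),
                (1 + growth L P) := by
            rw [Finset.mul_sum]
            refine Finset.sum_congr rfl fun S hS => ?_
            rw [Finset.filter_filter]
            congr 2
            refine Finset.prod_congr (Finset.filter_congr fun P _ => ?_) fun _ _ => rfl
            exact ⟨fun hP => ⟨hP.trans (Finset.mem_filter.1 hS).2, hP⟩, fun hP => hP.2⟩
        _ ≤ _ := Nat.mul_le_mul_left _ (sum_mul_prod_filter_le H.SSub (fun a ha => ha.2 rfl)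
              (fun _ _ _ h h' => h.trans h') (growth L) _)

theorem prod_one_add_growth_le (L : Finset (Concept NC NR)) :
    ∏ R ∈ partRoles L, (1 + growth L R) ≤ 2 ^ (2 * ∑ C ∈ L, C.partWeight) := by
  have h1 : ∀ R ∈ partRoles L, 1 + growth L R ≤ 2 ^ (2 * ∑ C ∈ cluster L R, C.partWeight) := by
    intro R hR
    obtain ⟨C, hC, hCR⟩ := Finset.mem_biUnion.1 hR
    have hCR : C.partRole = some R := by simpa using hCR
    have hmem : C ∈ cluster L R := Finset.mem_filter.2 ⟨hC, hCR⟩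
    have hw : 1 ≤ ∑ C ∈ cluster L R, C.partWeight :=
      (C.one_le_partWeight (by rw [hCR]; rfl)).trans
        (Finset.single_le_sum (f := Concept.partWeight) (fun _ _ => Nat.zero_le _) hmem)
    unfold growth
    have h2 : 2 ^ (1 + ∑ C ∈ cluster L R, C.partWeight) ≤
        2 ^ (2 * ∑ C ∈ cluster L R, C.partWeight) :=
      Nat.pow_le_pow_right (by norm_num) (by omega)
    have h3 : 1 ≤ 2 ^ ∑ C ∈ cluster L R, C.partWeight := Nat.one_le_two_pow
    rw [pow_add, pow_one] at h2
    omega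
  refine (Finset.prod_le_prod' h1).trans ?_
  rw [Finset.prod_pow_eq_pow_sum, ← Finset.mul_sum]
  refine Nat.pow_le_pow_right (by norm_num) (Nat.mul_le_mul_left _ ?_)
  rw [← Finset.sum_biUnion]
  · refine Finset.sum_le_sum_of_subset fun C hC => ?_
    obtain ⟨R, -, hR⟩ := Finset.mem_biUnion.1 hC
    exact (Finset.mem_filter.1 hR).1
  · intro R _ S _ hne
    refine Finset.disjoint_left.2 fun C hR hS => hne ?_
    have := (Finset.mem_filter.1 hR).2.symm.trans (Finset.mem_filter.1 hS).2
    simpa using this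

theorem banClusters_le (H : Hierarchy NR) (L : Finset (Concept NC NR)) {nbar X : ℕ} (hX : 1 ≤ X)
    (hn : nbar ≤ X) : banClusters H L nbar ≤ X * 2 ^ (2 * ∑ C ∈ L, C.partWeight) := by
  refine Finset.sup_le fun R hR => (satNum_le H L hX hn R).trans (Nat.mul_le_mul_left _ ?_)
  have hR := (Finset.mem_filter.1 hR).1
  refine le_trans ?_ (prod_one_add_growth_le L)
  rw [← Finset.mul_prod_erase _ _ hR]
  refine Nat.mul_le_mul (Nat.le_add_left _ _)
    (Finset.prod_le_prod_of_subset_of_one_le' (fun S hS => ?_) fun _ _ _ => Nat.le_add_right _ _)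
  obtain ⟨h1, h2⟩ := Finset.mem_filter.1 hS
  exact Finset.mem_erase.2 ⟨h2.2, h1⟩

theorem lcmOne_le (L : Finset (Concept NC NR)) : lcmOne L ≤ 2 ^ ∑ C ∈ L, C.partWeight := by
  have h1 : lcmOne L ≤ ∏ C ∈ wOne L, (C.wIndex.getD 0).den :=
    Nat.le_of_dvd (Finset.prod_pos fun C _ => Rat.den_pos _)
      (Finset.lcm_dvd fun C hC => Finset.dvd_prod_of_mem _ hC)
  refine h1.trans ((Finset.prod_le_prod' fun C _ => C.den_wIndex_le).trans ?_)
  rw [Finset.prod_pow_eq_pow_sum]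
  exact Nat.pow_le_pow_right (by norm_num) (Finset.sum_le_sum_of_subset (Finset.filter_subset _ _))

namespace Concept

theorem sum_partWeight_closure_le {D : Concept NC NR} (hD : D.IsNNF) (H : Hierarchy NR) :
    ∑ C ∈ D.closure H, C.partWeight ≤ 3 * D.length := by
  refine (sum_closure_le D H _ fun _ _ => rfl).trans ?_
  refine le_trans ?_ (Nat.mul_le_mul_left 3 (sum_headLength_subs_le D))
  rw [Finset.mul_sum]
  refine Finset.sum_le_sum fun E hE => ?_
  have hN := isNNF_of_mem_subs hD hE
  cases E with
  | neg A => obtain ⟨a, rfl⟩ := hN; simp [partWeight]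
  | atLeast n R C =>
    cases n with
    | zero => simp [compl_atLeast_zero, partWeight]
    | succ n =>
      simp [compl_atLeast_succ (show C.IsNNF from hN), compl_atMost (show C.IsNNF from hN),
        partWeight]
  | atMost n R C =>
    simp [compl_atLeast_succ (show C.IsNNF from hN), compl_atMost (show C.IsNNF from hN),
      partWeight]
  | M r R C => simp only [compl_M, compl_W, partWeight, headLength]; omega
  | W r R C => simp only [compl_M, compl_W, partWeight, headLength]; omega
  | _ => simp [partWeight]

theorem atLeastNum_le_of_mem_closure {D C : Concept NC NR} {H : Hierarchy NR} (hD : D.IsNNF)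
    (hC : C ∈ D.closure H) : C.exToAtLeast.atLeastNum ≤ 2 ^ D.length := by
  have h1 : 1 ≤ 2 ^ D.length := Nat.one_le_two_pow
  rcases Finset.mem_union.1 hC with hC | hC
  · obtain ⟨E, hE, h⟩ := mem_complSubs.1 hC
    have hN := isNNF_of_mem_subs hD hE
    have hlen := Nat.pow_le_pow_right (n := 2) (by norm_num) (headLength_le_of_mem_subs hE)
    cases E with
    | neg A =>
      obtain ⟨a, rfl⟩ := hN
      rcases h with rfl | rfl | rfl <;> simp [exToAtLeast, atLeastNum]
    | atLeast n R B =>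
      have hn := lt_two_pow_numLength n
      simp only [headLength, pow_add] at hlen
      cases n with
      | zero => rcases h with rfl | rfl | rfl <;> simp [compl_atLeast_zero, exToAtLeast, atLeastNum]
      | succ n =>
        rw [compl_atLeast_succ (show B.IsNNF from hN), compl_atMost (show B.IsNNF from hN)] at h
        rcases h with rfl | rfl | rfl <;> simp only [exToAtLeast, atLeastNum] <;> omega
    | atMost n R B =>
      have hn := lt_two_pow_numLength n
      simp only [headLength, pow_add] at hlen
      rw [compl_atMost (show B.IsNNF from hN), compl_atLeast_succ (show B.IsNNF from hN)] at h
      rcases h with rfl | rfl | rfl <;> simp only [exToAtLeast, atLeastNum] <;> omega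
    | _ =>
      rcases h with rfl | rfl | rfl <;> simp [exToAtLeast, atLeastNum, h1]
  · obtain ⟨p, -, rfl⟩ := Finset.mem_image.1 hC
    simp [exToAtLeast, atLeastNum]

/-- A bound of the border amounts of neighbours. -/
noncomputable def banBound (D : Concept NC NR) (H : Hierarchy NR) : ℕ :=
  ((D.closure H).card * 2 ^ D.length + (D.rolesWith H).card * (D.closure H).card +
    2 ^ D.length) * 2 ^ (9 * D.length)

theorem two_pow_length_le_banBound (D : Concept NC NR) (H : Hierarchy NR) :
    2 ^ D.length ≤ D.banBound H :=
  le_trans (Nat.le_add_left _ _) (Nat.le_mul_of_pos_right _ (Nat.two_pow_pos _))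

end Concept

namespace CTree

theorem nbar_le {D : Concept NC NR} {H : Hierarchy NR} (hD : D.IsNNF) {T : CTree NC NR}
    (hlab : ∀ x, T.label x ⊆ D.closure H) (hedge : ∀ x, T.edge x ⊆ D.rolesWith H) (x : List ℕ) :
    T.nbar H x ≤
      (D.closure H).card * 2 ^ D.length + (D.rolesWith H).card * (D.closure H).card := by
  refine (Concept.sum_union_le_add _ _ _).trans (Nat.add_le_add ?_ ?_)
  · refine (Concept.sum_image_le_sum _ _ _).trans ((Finset.sum_le_card_nsmul _ _ (2 ^ D.length)
      fun C hC => Concept.atLeastNum_le_of_mem_closure hD (hlab x hC)).trans ?_)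
    exact Nat.mul_le_mul_right _ (Finset.card_le_card (hlab x))
  · cases x with
    | nil => simp [inherited]
    | cons i u =>
      refine (Concept.sum_image_le_sum _ _ _).trans ?_
      simp only [Concept.atLeastNum, Finset.sum_const, smul_eq_mul, mul_one, Finset.card_product]
      refine Nat.mul_le_mul (Finset.card_image_le.trans (Finset.card_le_card ?_))
        (Finset.card_le_card (hlab u))
      exact Finset.biUnion_subset.2 fun R hR => Concept.supers_subset_rolesWith (hedge _ hR)

theorem BAN_le {D : Concept NC NR} {H : Hierarchy NR} (hD : D.IsNNF) {T : CTree NC NR}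
    (hlab : ∀ x, T.label x ⊆ D.closure H) (hedge : ∀ x, T.edge x ⊆ D.rolesWith H) (x : List ℕ) :
    T.BAN H x ≤ D.banBound H := by
  have hw : ∑ C ∈ T.label x, C.partWeight ≤ 3 * D.length :=
    (Finset.sum_le_sum_of_subset (hlab x)).trans (Concept.sum_partWeight_closure_le hD H)
  have h1 : 1 ≤ 2 ^ D.length := Nat.one_le_two_pow
  refine (Nat.mul_le_mul (banClusters_le H _ (h1.trans (Nat.le_add_left _ _))
    ((nbar_le hD hlab hedge x).trans (Nat.le_add_right _ _))) (lcmOne_le _)).trans ?_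
  rw [mul_assoc, ← pow_add]
  exact Nat.mul_le_mul_left _ (Nat.pow_le_pow_right (by norm_num) (by omega))

end CTree

end ALCQPIH

namespace ALCQPIH

variable {NC : Type u} {NR : Type v}

theorem IsSucc.asymm {x y : List ℕ} (h : IsSucc y x) : ¬ IsSucc x y := by
  rintro ⟨j, hj⟩
  obtain ⟨i, hi⟩ := h
  have h1 := congrArg List.length hi
  have h2 := congrArg List.length hj
  simp only [List.length_cons] at h1 h2
  omega

theorem IsSucc.ne {x y : List ℕ} (h : IsSucc y x) : y ≠ x := by
  rintro rfl
  exact h.asymm h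

theorem IsSucc.ne_nil {x y : List ℕ} (h : IsSucc y x) : y ≠ [] := by
  obtain ⟨i, rfl⟩ := h
  exact List.cons_ne_nil _ _

theorem IsSucc.unique {x x' y : List ℕ} (h : IsSucc y x) (h' : IsSucc y x') : x = x' := by
  obtain ⟨i, rfl⟩ := h
  obtain ⟨j, h'⟩ := h'
  exact (List.cons.inj h').2

namespace CTree

variable {D : Concept NC NR} {H : Hierarchy NR} {T T' : CTree NC NR}

/-- The node has not been merged into another one. -/
def Live (T : CTree NC NR) (x : List ℕ) : Prop := x = [] ∨ T.edge x ≠ ∅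

theorem live_of_not_blocked {x : List ℕ} (h : ¬ T.Blocked x) : T.Live x := by
  cases x with
  | nil => exact Or.inl rfl
  | cons i x => exact Or.inr fun h' => h (Or.inr (Or.inl h'))

/-- The neighbours of `x` in `C` that are linked to `x` by the role `R` itself. -/
noncomputable def linked (T : CTree NC NR) (x : List ℕ) (R : Role NR) (C : Concept NC NR) :
    Finset (List ℕ) :=
  T.nodes.filter fun y => R ∈ T.edgeBetween x y ∧ C ∈ T.label y

theorem linked_subset_nbrsWith (x : List ℕ) (R : Role NR) (C : Concept NC NR) :
    T.linked x R C ⊆ T.nbrsWith H R x C := by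
  intro y hy
  obtain ⟨hy, hR, hC⟩ := Finset.mem_filter.1 hy
  refine Finset.mem_filter.2 ⟨Finset.mem_filter.2 ⟨hy, ?_⟩, hC⟩
  unfold edgeBetween at hR
  split_ifs at hR with h1 h2
  · exact Or.inl ⟨h1, R, hR, Relation.ReflTransGen.refl⟩
  · obtain ⟨S, hS, rfl⟩ := Finset.mem_image.1 hR
    exact Or.inr ⟨h2, S, hS, by rw [Role.Inv_Inv]; exact Relation.ReflTransGen.refl⟩
  · exact absurd hR (Finset.notMem_empty _)

/-- The changes of a tree that the rules make, with those conditions of the rules on which the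
bounds depend. -/
inductive Move (D : Concept NC NR) (H : Hierarchy NR) (T : CTree NC NR) : CTree NC NR → Prop
  | add (y : List ℕ) (A : Finset (Concept NC NR)) :
      y ∈ T.nodes → A ⊆ D.closure H → ¬ A ⊆ T.label y → Move D H T (T.addConcepts y A)
  | merge (x y z : List ℕ) :
      y ∈ T.nodes → z ∈ T.nodes → IsSucc y x → T.edge y ≠ ∅ → y ≠ z →
      (IsSucc z x ∧ T.edge z ≠ ∅ ∨ IsSucc x z ∧ T.edge x ≠ ∅) →
      Disjoint (T.edgeBetween x y) (T.edgeBetween x z) → Move D H T (T.merge x y z)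
  | node (x y : List ℕ) (B C : Concept NC NR) (R : Role NR) :
      x ∈ T.nodes → y ∉ T.nodes → IsSucc y x → ¬ T.Blocked x → B ∈ D.closure H →
      B.box = some (R, C) → (T.linked x R C).card < D.banBound H → Move D H T (T.addNode y R C)

theorem NonGen.move (hD : D.IsNNF) (hlab : ∀ x, T.label x ⊆ D.closure H)
    (h : NonGen H T T') : Move D H T T' := by
  cases h with
  | and_rule x C₁ C₂ hx hC hb hn =>
    refine .add x _ hx ?_ ?_
    · have := Concept.parts_subset_closure hD (hlab x hC)
      simpa [Concept.parts] using this
    · simpa [Finset.insert_subset_iff] using hn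
  | or_rule x C₁ C₂ E hx hC hb h1 h2 hE =>
    refine .add x _ hx ?_ ?_
    · have := Concept.parts_subset_closure hD (hlab x hC)
      simp only [Concept.parts, Finset.insert_subset_iff, Finset.singleton_subset_iff] at this
      rcases hE with rfl | rfl
      · exact Finset.singleton_subset_iff.2 this.1
      · exact Finset.singleton_subset_iff.2 this.2
    · rcases hE with rfl | rfl <;> simpa
  | all_rule x y R C hx hC hb hy hn =>
    refine .add y _ (Finset.mem_filter.1 hy).1 ?_ (by simpa)
    have := Concept.parts_subset_closure hD (hlab x hC)
    simpa [Concept.parts] using this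
  | all_plus_rule x y R S C hx hC hb hR hRS hy hn =>
    refine .add y _ (Finset.mem_filter.1 hy).1 ?_ (by simpa)
    exact Finset.singleton_subset_iff.2 (Concept.all_mem_closure_of_sub hD (hlab x hC) hRS)
  | choose_rule x y R B C E hx hB hbox hb hy h1 h2 hE =>
    refine .add y _ (Finset.mem_filter.1 hy).1 ?_ ?_
    · rw [Finset.singleton_subset_iff]
      rcases hE with rfl | rfl
      · exact Concept.parts_subset_closure hD (hlab x hB) (Concept.box_mem_parts hbox)
      · exact Concept.compl_mem_closure_of_box hD (hlab x hB) hbox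
    · rcases hE with rfl | rfl <;> simpa
  | atMost_rule x y z n R C hx hC hb hn hy hz hne hdis hnp =>
    obtain ⟨hyn, hyR⟩ := Finset.mem_filter.1 (Finset.mem_filter.1 hy).1
    obtain ⟨hzn, hzR⟩ := Finset.mem_filter.1 (Finset.mem_filter.1 hz).1
    rcases hyR with ⟨hyx, S, hS, -⟩ | ⟨hyx, -⟩
    · refine .merge x y z hyn hzn hyx (Finset.ne_empty_of_mem hS) hne ?_ hdis
      rcases hzR with ⟨hzx, S, hS, -⟩ | ⟨hzx, S, hS, -⟩
      · exact Or.inl ⟨hzx, Finset.ne_empty_of_mem hS⟩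
      · exact Or.inr ⟨hzx, Finset.ne_empty_of_mem hS⟩
    · exact absurd hyx hnp

theorem Gen.move (hD : D.IsNNF) (hlab : ∀ x, T.label x ⊆ D.closure H)
    (hedge : ∀ x, T.edge x ⊆ D.rolesWith H) (h : Gen H T T') : Move D H T T' := by
  have hle : ∀ x R C, (T.linked x R C).card ≤ (T.nbrsWith H R x C).card := fun x R C =>
    Finset.card_le_card (linked_subset_nbrsWith x R C)
  have hle' : ∀ x R C, (T.nbrsWith H R x C).card ≤ (T.nbrs H R x).card := fun x R C =>
    Finset.card_le_card (Finset.filter_subset _ _)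
  have hpow := D.two_pow_length_le_banBound H
  cases h with
  | ex_rule x y R C hx hC hb hn hy hyn =>
    refine .node x y _ C R hx hyn hy hb (hlab x hC) rfl ?_
    have := hle x R C
    rw [hn, Finset.card_empty] at this
    have h1 : 1 ≤ 2 ^ D.length := Nat.one_le_two_pow
    omega
  | atLeast_rule x y n R C hx hC hb hn hy hyn =>
    refine .node x y _ C R hx hyn hy hb (hlab x hC) rfl ?_
    have h1 : n ≤ 2 ^ D.length := Concept.atLeastNum_le_of_mem_closure hD (hlab x hC)
    exact (hle x R C).trans_lt (hn.trans_le (h1.trans hpow))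
  | M_rule x y r R C hx hC hb hr hn hy hyn =>
    exact .node x y _ C R hx hyn hy hb (hlab x hC) rfl
      (((hle x R C).trans (hle' x R C)).trans_lt (hn.trans_le (BAN_le hD hlab hedge x)))
  | W_rule x y r R C hx hC hb hr hn hy hyn =>
    exact .node x y _ C R hx hyn hy hb (hlab x hC) rfl
      (((hle x R C).trans (hle' x R C)).trans_lt (hn.trans_le (BAN_le hD hlab hedge x)))

theorem Step.move (hD : D.IsNNF) (hlab : ∀ x, T.label x ⊆ D.closure H)
    (hedge : ∀ x, T.edge x ⊆ D.rolesWith H) (h : Step H T T') : Move D H T T' := by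
  rcases h with h | ⟨-, h⟩
  · exact h.move hD hlab
  · exact h.move hD hlab hedge

theorem label_subset_addConcepts (y : List ℕ) (A : Finset (Concept NC NR)) (v : List ℕ) :
    T.label v ⊆ (T.addConcepts y A).label v := by
  by_cases hv : v = y
  · subst hv; simp [addConcepts]
  · simp [addConcepts, hv]

theorem label_subset_merge (x y z v : List ℕ) : T.label v ⊆ (T.merge x y z).label v := by
  by_cases hv : v = z
  · subst hv; simp [CTree.merge]
  · simp [CTree.merge, hv]

theorem edge_subset_merge {x y z v : List ℕ} (hv : v ≠ y) :
    T.edge v ⊆ (T.merge x y z).edge v := by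
  simp only [CTree.merge, Function.update_of_ne hv]
  split_ifs
  · by_cases h : v = x
    · subst h; simp
    · simp [h]
  · by_cases h : v = z
    · subst h; simp
    · simp [h]

theorem edge_merge_self (x y z : List ℕ) : (T.merge x y z).edge y = ∅ := by
  simp [CTree.merge]

theorem edge_merge_eq_empty {x y z v : List ℕ}
    (h : IsSucc z x ∧ T.edge z ≠ ∅ ∨ IsSucc x z ∧ T.edge x ≠ ∅) (hv : T.edge v = ∅) :
    (T.merge x y z).edge v = ∅ := by
  by_cases hvy : v = y
  · rw [hvy, edge_merge_self]
  · simp only [CTree.merge, Function.update_of_ne hvy]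
    split_ifs with hxz
    · rcases h with h | h
      · exact absurd hxz h.1.asymm
      · rw [Function.update_of_ne (by rintro rfl; exact h.2 hv), hv]
    · rcases h with h | h
      · rw [Function.update_of_ne (by rintro rfl; exact h.2 hv), hv]
      · exact absurd h.1 hxz

theorem edgeBetween_subset_merge {x y z x' w : List ℕ} (hx' : x' ≠ y) (hw : w ≠ y ∨ ¬ IsSucc w x') :
    T.edgeBetween x' w ⊆ (T.merge x y z).edgeBetween x' w := by
  unfold edgeBetween
  split_ifs with h1 h2
  · exact edge_subset_merge (hw.resolve_right fun h => h h1)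
  · exact Finset.image_subset_image (edge_subset_merge hx')
  · exact subset_rfl

theorem edgeBetween_subset_merge_target {x y z : List ℕ} (hyx : IsSucc y x) (hyz : y ≠ z)
    (hz : IsSucc z x ∨ IsSucc x z) :
    T.edgeBetween x y ⊆ (T.merge x y z).edgeBetween x z := by
  have hxy : x ≠ y := fun h => hyx.ne h.symm
  unfold edgeBetween
  rw [if_pos hyx]
  rcases hz with hz | hz
  · rw [if_pos hz]
    simp [CTree.merge, hz.asymm, hyz.symm]
  · rw [if_neg hz.asymm, if_pos hz]
    intro R hR
    refine Finset.mem_image.2 ⟨R.Inv, ?_, R.Inv_Inv⟩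
    simp only [CTree.merge, if_pos hz, Function.update_of_ne hxy, Function.update_self]
    exact Finset.mem_union_right _ (Finset.mem_image_of_mem _ hR)

theorem card_linked_merge_le {x y z : List ℕ} (hz : z ∈ T.nodes) (hyx : IsSucc y x) (hyz : y ≠ z)
    (hzx : IsSucc z x ∨ IsSucc x z)
    (hdis : Disjoint (T.edgeBetween x y) (T.edgeBetween x z)) {x' : List ℕ} (hx' : x' ≠ y)
    (R : Role NR) (C : Concept NC NR) :
    (T.linked x' R C).card ≤ ((T.merge x y z).linked x' R C).card := by
  by_cases hxx : x' = x
  · subst hxx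
    refine Finset.card_le_card_of_injOn (fun w => if w = y then z else w) ?_ ?_
    · intro w hw
      obtain ⟨hw, hR, hC⟩ := Finset.mem_filter.1 hw
      by_cases hwy : w = y
      · subst hwy
        simp only [if_true]
        refine Finset.mem_filter.2 ⟨hz, edgeBetween_subset_merge_target hyx hyz hzx hR, ?_⟩
        simp [CTree.merge, hC]
      · simp only [if_neg hwy]
        exact Finset.mem_filter.2 ⟨hw, edgeBetween_subset_merge hx' (Or.inl hwy) hR,
          label_subset_merge _ _ _ _ hC⟩
    · intro w hw w' hw' h
      have hwR := (Finset.mem_filter.1 hw).2.1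
      have hwR' := (Finset.mem_filter.1 hw').2.1
      simp only at h
      split_ifs at h with h1 h2 h2
      · rw [h1, h2]
      · subst h1 h; exact absurd hwR' (Finset.disjoint_left.1 hdis hwR)
      · subst h2 h; exact absurd hwR (Finset.disjoint_left.1 hdis hwR')
      · exact h
  · refine Finset.card_le_card fun w hw => ?_
    obtain ⟨hw, hR, hC⟩ := Finset.mem_filter.1 hw
    refine Finset.mem_filter.2 ⟨hw, edgeBetween_subset_merge hx' ?_ hR,
      label_subset_merge _ _ _ _ hC⟩
    by_cases hwy : w = y
    · subst hwy
      exact Or.inr fun h => hxx (h.unique hyx)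
    · exact Or.inl hwy

theorem linked_subset_addNode {y : List ℕ} {R : Role NR} {C : Concept NC NR} (hy : y ∉ T.nodes)
    {x : List ℕ} (hx : x ∈ T.nodes) (S : Role NR) (E : Concept NC NR) :
    T.linked x S E ⊆ (T.addNode y R C).linked x S E := by
  intro w hw
  obtain ⟨hw, hR, hC⟩ := Finset.mem_filter.1 hw
  have hwy : w ≠ y := fun h => hy (h ▸ hw)
  have hxy : x ≠ y := fun h => hy (h ▸ hx)
  refine Finset.mem_filter.2 ⟨Finset.mem_insert_of_mem hw, ?_, ?_⟩
  · simpa [edgeBetween, addNode, hwy, hxy] using hR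
  · simpa [addNode, hwy] using hC

theorem card_linked_lt_addNode {x y : List ℕ} {R : Role NR} {C : Concept NC NR}
    (hy : y ∉ T.nodes) (hx : x ∈ T.nodes) (hyx : IsSucc y x) :
    (T.linked x R C).card < ((T.addNode y R C).linked x R C).card := by
  refine Finset.card_lt_card ⟨linked_subset_addNode hy hx R C, fun h => hy ?_⟩
  have : y ∈ (T.addNode y R C).linked x R C :=
    Finset.mem_filter.2 ⟨Finset.mem_insert_self _ _, by simp [edgeBetween, addNode, hyx],
      by simp [addNode]⟩
  exact (Finset.mem_filter.1 (h this)).1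

/-- The number of the neighbours of `x` that satisfy the demand of a concept `⊠ R.C`, and are
linked to `x` by `R` itself. -/
noncomputable def linkNum (T : CTree NC NR) (x : List ℕ) (B : Concept NC NR) : ℕ :=
  match B.box with
  | some (R, C) => (T.linked x R C).card
  | none => 0

theorem linkNum_of_box {B C : Concept NC NR} {R : Role NR} (h : B.box = some (R, C))
    (x : List ℕ) : T.linkNum x B = (T.linked x R C).card := by
  simp [linkNum, h]

theorem linkNum_le_linkNum {x : List ℕ} (B : Concept NC NR)
    (h : ∀ R C, (T.linked x R C).card ≤ (T'.linked x R C).card) :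
    T.linkNum x B ≤ T'.linkNum x B := by
  unfold linkNum
  split
  · exact h _ _
  · exact le_rfl

/-- The sum of the numbers `linkNum`, each of them cut off at `banBound`. -/
noncomputable def linkSum (D : Concept NC NR) (H : Hierarchy NR) (T : CTree NC NR)
    (x : List ℕ) : ℕ :=
  ∑ B ∈ D.closure H, min (T.linkNum x B) (D.banBound H)

theorem linkSum_le (D : Concept NC NR) (H : Hierarchy NR) (T : CTree NC NR) (x : List ℕ) :
    linkSum D H T x ≤ (D.closure H).card * D.banBound H :=
  Finset.sum_le_card_nsmul _ _ _ fun _ _ => min_le_right _ _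

theorem linkSum_le_linkSum {x : List ℕ}
    (h : ∀ R C, (T.linked x R C).card ≤ (T'.linked x R C).card) :
    linkSum D H T x ≤ linkSum D H T' x :=
  Finset.sum_le_sum fun B _ => min_le_min_right _ (linkNum_le_linkNum B h)

theorem linkSum_lt_addNode {x y : List ℕ} {B C : Concept NC NR} {R : Role NR}
    (hx : x ∈ T.nodes) (hy : y ∉ T.nodes) (hyx : IsSucc y x) (hB : B ∈ D.closure H)
    (hbox : B.box = some (R, C)) (hlt : (T.linked x R C).card < D.banBound H) :
    linkSum D H T x < linkSum D H (T.addNode y R C) x := by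
  refine Finset.sum_lt_sum (fun E _ => min_le_min_right _ (linkNum_le_linkNum E fun S F =>
    Finset.card_le_card (linked_subset_addNode hy hx S F))) ⟨B, hB, ?_⟩
  have := card_linked_lt_addNode (R := R) (C := C) hy hx hyx
  rw [linkNum_of_box hbox, linkNum_of_box hbox]
  omega

theorem outDegree_addNode_of_not_isSucc {x y : List ℕ} (R : Role NR) (C : Concept NC NR)
    (h : ¬ IsSucc y x) : (T.addNode y R C).outDegree x = T.outDegree x := by
  simp [outDegree, addNode, Finset.filter_insert, h]

theorem outDegree_addNode_le (x y : List ℕ) (R : Role NR) (C : Concept NC NR) :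
    (T.addNode y R C).outDegree x ≤ T.outDegree x + 1 := by
  unfold outDegree
  simp only [addNode, Finset.filter_insert]
  split_ifs
  · exact Finset.card_insert_le _ _
  · exact Nat.le_succ _

/-- The labels of the nodes and edges at the non-root ancestors of `x`, including `x`. -/
noncomputable def triples (T : CTree NC NR) : List ℕ →
    Finset (Finset (Concept NC NR) × Finset (Concept NC NR) × Finset (Role NR))
  | [] => ∅
  | i :: x => insert (T.label (i :: x), T.label x, T.edge (i :: x)) (T.triples x)

theorem exists_of_mem_triples {x : List ℕ}
    {p : Finset (Concept NC NR) × Finset (Concept NC NR) × Finset (Role NR)}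
    (h : p ∈ T.triples x) :
    ∃ (j : ℕ) (y : List ℕ), (j :: y) <:+ x ∧ p = (T.label (j :: y), T.label y, T.edge (j :: y)) := by
  induction x with
  | nil => simp [triples] at h
  | cons i x ih =>
    rcases Finset.mem_insert.1 h with rfl | h
    · exact ⟨i, x, List.suffix_rfl, rfl⟩
    · obtain ⟨j, y, hy, hp⟩ := ih h
      exact ⟨j, y, hy.trans (List.suffix_cons i x), hp⟩

theorem card_triples_of_not_blocked {x : List ℕ} (h : ¬ T.Blocked x) :
    (T.triples x).card = x.length := by
  induction x with
  | nil => simp [triples]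
  | cons i x ih =>
    rw [triples, Finset.card_insert_of_notMem, ih fun hx => h (Or.inl hx), List.length_cons]
    intro hmem
    obtain ⟨j, y, hy, hp⟩ := exists_of_mem_triples hmem
    simp only [Prod.mk.injEq] at hp
    exact h (Or.inr (Or.inr ⟨j, y, hy, hp⟩))

theorem triples_subset {x : List ℕ} (hlab : ∀ x, T.label x ⊆ D.closure H)
    (hedge : ∀ x, T.edge x ⊆ D.rolesWith H) (h : ¬ T.Blocked x) :
    T.triples x ⊆ (D.closure H).powerset ×ˢ (D.closure H).powerset ×ˢ
      (D.rolesWith H).powerset.erase ∅ := by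
  induction x with
  | nil => simp [triples]
  | cons i x ih =>
    refine Finset.insert_subset ?_ (ih fun hx => h (Or.inl hx))
    simp only [Finset.mem_product, Finset.mem_powerset, Finset.mem_erase]
    exact ⟨hlab _, hlab _, fun h' => h (Or.inr (Or.inl h')), hedge _⟩

theorem length_lt_of_not_blocked {x : List ℕ} (hlab : ∀ x, T.label x ⊆ D.closure H)
    (hedge : ∀ x, T.edge x ⊆ D.rolesWith H) (h : ¬ T.Blocked x) :
    x.length < 2 ^ (2 * (D.closure H).card + (D.rolesWith H).card) := by
  have h1 := Finset.card_le_card (triples_subset hlab hedge h)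
  rw [card_triples_of_not_blocked h, Finset.card_product, Finset.card_product,
    Finset.card_erase_of_mem (Finset.empty_mem_powerset _), Finset.card_powerset,
    Finset.card_powerset, ← mul_assoc, ← pow_add, ← two_mul] at h1
  refine h1.trans_lt ?_
  rw [pow_add]
  exact Nat.mul_lt_mul_of_pos_left (Nat.sub_lt (Nat.two_pow_pos _) one_pos) (Nat.two_pow_pos _)

/-- The properties of the generated trees from which the bounds follow. -/
structure Bounded (D : Concept NC NR) (H : Hierarchy NR) (T : CTree NC NR) : Prop where
  tail : ∀ i x, i :: x ∈ T.nodes → x ∈ T.nodes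
  label : ∀ x, T.label x ⊆ D.closure H
  edge : ∀ x, T.edge x ⊆ D.rolesWith H
  depth : ∀ x ∈ T.nodes, x = [] ∨ 2 ≤ (D.rolesWith H).card ∧
    x.length ≤ 2 ^ (2 * (D.closure H).card + (D.rolesWith H).card)
  outDegree_le : ∀ x ∈ T.nodes, T.outDegree x ≤ (D.closure H).card * D.banBound H
  outDegree_le_linkSum : ∀ x ∈ T.nodes, T.Live x → T.outDegree x ≤ linkSum D H T x

theorem bounded_init (D : Concept NC NR) (H : Hierarchy NR) : Bounded D H (init D) := by
  have hdeg : ∀ x, (init D).outDegree x = 0 := by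
    intro x
    refine Finset.card_eq_zero.2 (Finset.filter_eq_empty_iff.2 fun y hy hyx => hyx.ne_nil ?_)
    simpa [init] using hy
  refine ⟨?_, ?_, ?_, ?_, ?_, ?_⟩
  · intro i x h
    simp [init] at h
  · intro x
    simp only [init]
    split_ifs
    · exact Finset.singleton_subset_iff.2 (D.self_mem_closure H)
    · exact Finset.empty_subset _
  · intro x
    exact Finset.empty_subset _
  · intro x hx
    exact Or.inl (by simpa [init] using hx)
  · intro x _
    rw [hdeg]
    exact Nat.zero_le _
  · intro x _ _
    rw [hdeg]
    exact Nat.zero_le _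

theorem Bounded.addConcepts (h : Bounded D H T) {y : List ℕ} {A : Finset (Concept NC NR)}
    (hA : A ⊆ D.closure H) : Bounded D H (T.addConcepts y A) := by
  refine ⟨h.tail, fun x => ?_, h.edge, h.depth, h.outDegree_le, fun x hx hl => ?_⟩
  · by_cases hxy : x = y
    · subst hxy
      simpa [CTree.addConcepts] using Finset.union_subset (h.label x) hA
    · simpa [CTree.addConcepts, hxy] using h.label x
  · refine (h.outDegree_le_linkSum x hx hl).trans (linkSum_le_linkSum fun R C =>
      Finset.card_le_card fun w hw => ?_)
    obtain ⟨hw, hR, hC⟩ := Finset.mem_filter.1 hw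
    exact Finset.mem_filter.2 ⟨hw, hR, label_subset_addConcepts y A w hC⟩

theorem edge_merge_subset (h : Bounded D H T) (x y z v : List ℕ) :
    (T.merge x y z).edge v ⊆ D.rolesWith H := by
  have himage : (T.edge y).image Role.Inv ⊆ D.rolesWith H := by
    intro R hR
    obtain ⟨S, hS, rfl⟩ := Finset.mem_image.1 hR
    exact Concept.Inv_mem_rolesWith (h.edge y hS)
  by_cases hvy : v = y
  · rw [hvy, edge_merge_self]; exact Finset.empty_subset _
  · simp only [CTree.merge, Function.update_of_ne hvy]
    split_ifs
    · by_cases hvx : v = x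
      · subst hvx
        simpa using Finset.union_subset (h.edge v) himage
      · simpa [hvx] using h.edge v
    · by_cases hvz : v = z
      · subst hvz
        simpa using Finset.union_subset (h.edge v) (h.edge y)
      · simpa [hvz] using h.edge v

theorem Bounded.merge (h : Bounded D H T) {x y z : List ℕ} (hz : z ∈ T.nodes)
    (hyx : IsSucc y x) (hyz : y ≠ z)
    (hzx : IsSucc z x ∧ T.edge z ≠ ∅ ∨ IsSucc x z ∧ T.edge x ≠ ∅)
    (hdis : Disjoint (T.edgeBetween x y) (T.edgeBetween x z)) :
    Bounded D H (T.merge x y z) := by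
  refine ⟨h.tail, fun v => ?_, edge_merge_subset h x y z, h.depth, h.outDegree_le,
    fun v hv hl => ?_⟩
  · by_cases hvz : v = z
    · subst hvz
      simpa [CTree.merge] using Finset.union_subset (h.label v) (h.label y)
    · simpa [CTree.merge, hvz] using h.label v
  · have hvy : v ≠ y := by
      rintro rfl
      rcases hl with hl | hl
      · exact hyx.ne_nil hl
      · exact hl (edge_merge_self _ _ _)
    have hl' : T.Live v := hl.imp id fun h1 h2 => h1 (edge_merge_eq_empty hzx h2)
    exact (h.outDegree_le_linkSum v hv hl').trans (linkSum_le_linkSum fun R C =>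
      card_linked_merge_le hz hyx hyz (hzx.imp And.left And.left) hdis hvy R C)

theorem Bounded.addNode (hD : D.IsNNF) (h : Bounded D H T) {x y : List ℕ} {B C : Concept NC NR}
    {R : Role NR} (hx : x ∈ T.nodes) (hy : y ∉ T.nodes) (hyx : IsSucc y x) (hb : ¬ T.Blocked x)
    (hB : B ∈ D.closure H) (hbox : B.box = some (R, C))
    (hlt : (T.linked x R C).card < D.banBound H) : Bounded D H (T.addNode y R C) := by
  have hR : R ∈ D.rolesWith H := Concept.box_role_mem hD hB hbox
  have hC : C ∈ D.closure H := Concept.parts_subset_closure hD hB (Concept.box_mem_parts hbox)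
  have hnew : (T.addNode y R C).outDegree y = 0 := by
    rw [outDegree_addNode_of_not_isSucc R C fun h => h.ne rfl]
    refine Finset.card_eq_zero.2 (Finset.filter_eq_empty_iff.2 fun w hw hwy => hy ?_)
    obtain ⟨i, rfl⟩ := hwy
    exact h.tail i y hw
  have hlink : ∀ v ∈ (T.addNode y R C).nodes, (T.addNode y R C).Live v →
      (T.addNode y R C).outDegree v ≤ linkSum D H (T.addNode y R C) v := by
    intro v hv hl
    by_cases hvy : v = y
    · rw [hvy, hnew]; exact Nat.zero_le _
    · have hv' : v ∈ T.nodes := (Finset.mem_insert.1 hv).resolve_left hvy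
      have hl' : T.Live v := by
        rcases hl with hl | hl
        · exact Or.inl hl
        · exact Or.inr (by simpa [CTree.addNode, hvy] using hl)
      by_cases hvx : v = x
      · subst hvx
        have h1 := outDegree_addNode_le (T := T) v y R C
        have h2 := h.outDegree_le_linkSum v hx hl'
        have h3 := linkSum_lt_addNode hx hy hyx hB hbox hlt
        omega
      · rw [outDegree_addNode_of_not_isSucc R C fun h => hvx (h.unique hyx)]
        exact (h.outDegree_le_linkSum v hv' hl').trans (linkSum_le_linkSum fun S F =>
          Finset.card_le_card (linked_subset_addNode hy hv' S F))
  refine ⟨fun i v hv => ?_, fun v => ?_, fun v => ?_, fun v hv => ?_, fun v hv => ?_, hlink⟩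
  · rcases Finset.mem_insert.1 hv with hv | hv
    · exact Finset.mem_insert_of_mem ((IsSucc.unique ⟨i, hv.symm⟩ hyx) ▸ hx)
    · exact Finset.mem_insert_of_mem (h.tail i v hv)
  · by_cases hvy : v = y
    · subst hvy
      simpa [CTree.addNode] using hC
    · simpa [CTree.addNode, hvy] using h.label v
  · by_cases hvy : v = y
    · subst hvy
      simpa [CTree.addNode] using hR
    · simpa [CTree.addNode, hvy] using h.edge v
  · rcases Finset.mem_insert.1 hv with rfl | hv
    · refine Or.inr ⟨Concept.two_le_card_rolesWith hR, ?_⟩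
      have := length_lt_of_not_blocked h.label h.edge hb
      obtain ⟨i, rfl⟩ := hyx
      exact this
    · exact h.depth v hv
  · rcases Finset.mem_insert.1 hv with rfl | hv'
    · rw [hnew]; exact Nat.zero_le _
    · by_cases hvx : v = x
      · subst hvx
        refine (hlink v hv ?_).trans (linkSum_le _ _ _ _)
        have hvy : v ≠ y := fun h => hyx.ne h.symm
        rcases live_of_not_blocked hb with hl | hl
        · exact Or.inl hl
        · exact Or.inr (by simpa [CTree.addNode, hvy] using hl)
      · rw [outDegree_addNode_of_not_isSucc R C fun h => hvx (h.unique hyx)]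
        exact h.outDegree_le v hv'

theorem Move.bounded (hD : D.IsNNF) (h : Bounded D H T) (hm : Move D H T T') :
    Bounded D H T' := by
  cases hm with
  | add y A hy hA hn => exact h.addConcepts hA
  | merge x y z hy hz hyx hey hyz hzx hdis => exact h.merge hz hyx hyz hzx hdis
  | node x y B C R hx hy hyx hb hB hbox hlt => exact h.addNode hD hx hy hyx hb hB hbox hlt

theorem IsRun.bounded (hD : D.IsNNF) {m : ℕ} {t : ℕ → CTree NC NR} (h : IsRun H D m t) :
    ∀ i ≤ m, Bounded D H (t i) := by
  intro i
  induction i with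
  | zero => intro _; rw [h.1]; exact bounded_init D H
  | succ i ih =>
    intro hi
    have hb := ih (by omega)
    exact ((h.2 i (by omega)).move hD hb.label hb.edge).bounded hD hb

/-! ### Termination -/

/-- The contribution of a node to the measure that increases with every rule application, where
`k` bounds the number of roles on an edge. -/
noncomputable def nodeValue (k : ℕ) (T : CTree NC NR) (x : List ℕ) : ℕ :=
  1 + (T.label x).card + if T.edge x = ∅ then k + 1 else (T.edge x).card

/-- A measure that increases with every rule application. -/
noncomputable def value (k : ℕ) (T : CTree NC NR) : ℕ := ∑ x ∈ T.nodes, T.nodeValue k x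

theorem nodeValue_le (h : Bounded D H T) (x : List ℕ) :
    T.nodeValue (D.rolesWith H).card x ≤ 2 + (D.closure H).card + (D.rolesWith H).card := by
  have h1 := Finset.card_le_card (h.label x)
  have h2 := Finset.card_le_card (h.edge x)
  unfold nodeValue
  split_ifs <;> omega

theorem Move.value_lt (h : Bounded D H T) (hm : Move D H T T') :
    T.value (D.rolesWith H).card < T'.value (D.rolesWith H).card := by
  cases hm with
  | add y A hy hA hn =>
    refine Finset.sum_lt_sum (fun v _ => ?_) ⟨y, hy, ?_⟩
    · exact Nat.add_le_add_right (Nat.add_le_add_left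
        (Finset.card_le_card (label_subset_addConcepts y A v)) _) _
    · refine Nat.add_lt_add_right (Nat.add_lt_add_left (Finset.card_lt_card
        ⟨label_subset_addConcepts y A y, fun hs => hn ?_⟩) _) _
      refine subset_trans ?_ hs
      simp [CTree.addConcepts]
  | merge x y z hy hz hyx hey hyz hzx hdis =>
    have hlab : ∀ v, (T.label v).card ≤ ((T.merge x y z).label v).card := fun v =>
      Finset.card_le_card (label_subset_merge x y z v)
    have hlt : T.nodeValue (D.rolesWith H).card y <
        (T.merge x y z).nodeValue (D.rolesWith H).card y := by
      have h1 := Finset.card_le_card (h.edge y)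
      have h2 := hlab y
      unfold nodeValue
      rw [if_neg hey, if_pos (edge_merge_self x y z)]
      omega
    refine Finset.sum_lt_sum (fun v _ => ?_) ⟨y, hy, hlt⟩
    by_cases hvy : v = y
    · subst hvy; exact hlt.le
    · have h1 := hlab v
      have h2 := Finset.card_le_card (edge_subset_merge (T := T) (x := x) (z := z) hvy)
      unfold nodeValue
      by_cases hv : T.edge v = ∅
      · rw [if_pos hv, if_pos (edge_merge_eq_empty hzx hv)]
        omega
      · rw [if_neg hv]
        split_ifs with hv'
        · rw [hv', Finset.card_empty] at h2
          omega
        · omega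
  | node x y B C R hx hy hyx hb hB hbox hlt =>
    unfold value
    simp only [CTree.addNode]
    rw [Finset.sum_insert hy]
    have h1 : ∑ v ∈ T.nodes, T.nodeValue (D.rolesWith H).card v =
        ∑ v ∈ T.nodes, (T.addNode y R C).nodeValue (D.rolesWith H).card v := by
      refine Finset.sum_congr rfl fun v hv => ?_
      have hvy : v ≠ y := fun h => hy (h ▸ hv)
      simp [nodeValue, CTree.addNode, hvy]
    rw [h1]
    simp only [CTree.addNode]
    refine Nat.lt_add_of_pos_left ?_
    unfold nodeValue
    omega

theorem card_nodes_le {b : ℕ} (htail : ∀ i x, i :: x ∈ T.nodes → x ∈ T.nodes)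
    (hdeg : ∀ x ∈ T.nodes, T.outDegree x ≤ b) (l : ℕ) :
    (T.nodes.filter fun x => x.length ≤ l).card ≤ (b + 1) ^ l := by
  induction l with
  | zero =>
    rw [pow_zero, Finset.card_le_one]
    intro x hx y hy
    simp only [Finset.mem_filter, nonpos_iff_eq_zero, List.length_eq_zero_iff] at hx hy
    rw [hx.2, hy.2]
  | succ l ih =>
    have hsub : (T.nodes.filter fun x => x.length ≤ l + 1) ⊆
        (T.nodes.filter fun x => x.length ≤ l) ∪ (T.nodes.filter fun x => x.length ≤ l).biUnion
          fun x => T.nodes.filter fun y => IsSucc y x := by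
      intro x hx
      obtain ⟨hx, hl⟩ := Finset.mem_filter.1 hx
      cases x with
      | nil => exact Finset.mem_union_left _ (Finset.mem_filter.2 ⟨hx, Nat.zero_le _⟩)
      | cons i x =>
        refine Finset.mem_union_right _ (Finset.mem_biUnion.2 ⟨x, Finset.mem_filter.2
          ⟨htail i x hx, ?_⟩, Finset.mem_filter.2 ⟨hx, i, rfl⟩⟩)
        simpa using hl
    refine (Finset.card_le_card hsub).trans ((Finset.card_union_le _ _).trans ?_)
    have h2 := Finset.card_biUnion_le_card_mul (T.nodes.filter fun x => x.length ≤ l)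
      (fun x => T.nodes.filter fun y => IsSucc y x) b
      fun x hx => hdeg x (Finset.mem_filter.1 hx).1
    calc _ ≤ (T.nodes.filter fun x => x.length ≤ l).card +
          (T.nodes.filter fun x => x.length ≤ l).card * b := Nat.add_le_add_left h2 _
      _ = (T.nodes.filter fun x => x.length ≤ l).card * (b + 1) := by ring
      _ ≤ (b + 1) ^ l * (b + 1) := Nat.mul_le_mul_right _ ih
      _ = _ := (pow_succ _ _).symm

/-- A bound of the lengths of the runs. -/
noncomputable def runBound (D : Concept NC NR) (H : Hierarchy NR) : ℕ :=
  ((D.closure H).card * D.banBound H + 1) ^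
      2 ^ (2 * (D.closure H).card + (D.rolesWith H).card) *
    (2 + (D.closure H).card + (D.rolesWith H).card)

theorem value_le (h : Bounded D H T) : T.value (D.rolesWith H).card ≤ runBound D H := by
  refine (Finset.sum_le_card_nsmul _ _ _ fun x _ => nodeValue_le h x).trans
    (Nat.mul_le_mul_right _ ?_)
  have hall : (T.nodes.filter fun x =>
      x.length ≤ 2 ^ (2 * (D.closure H).card + (D.rolesWith H).card)) = T.nodes := by
    refine Finset.filter_eq_self.2 fun x hx => ?_
    rcases h.depth x hx with rfl | hx
    · exact Nat.zero_le _
    · exact hx.2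
  rw [← hall]
  exact card_nodes_le h.tail h.outDegree_le _

theorem IsRun.le_runBound (hD : D.IsNNF) {m : ℕ} {t : ℕ → CTree NC NR} (h : IsRun H D m t) :
    m ≤ runBound D H := by
  have hb := h.bounded hD
  have key : ∀ i ≤ m, i ≤ (t i).value (D.rolesWith H).card := by
    intro i
    induction i with
    | zero => exact fun _ => Nat.zero_le _
    | succ i ih =>
      intro hi
      have hbi := hb i (by omega)
      have := ((h.2 i (by omega)).move hD hbi.label hbi.edge).value_lt hbi
      have := ih (by omega)
      omega
  exact (key m le_rfl).trans (value_le (hb m le_rfl))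

end CTree

/-! ### The numerical bounds -/

namespace Concept

theorem closure_exponent_le (D : Concept NC NR) (H : Hierarchy NR)
    (hk : 2 ≤ (D.rolesWith H).card) :
    2 * (D.closure H).card + (D.rolesWith H).card ≤ 4 * D.length * (D.rolesWith H).card := by
  have h1 := D.card_closure_le H
  have h2 := D.card_subs_add_numQuant_le
  have h3 := D.two_mul_numQuant_lt
  generalize (D.rolesWith H).card = k at *
  generalize (D.closure H).card = c at *
  generalize D.subs.card = s at *
  generalize D.numQuant = q at *
  generalize D.length = n at *
  obtain ⟨j, rfl⟩ := Nat.exists_eq_add_of_le hk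
  obtain ⟨e, rfl⟩ := Nat.exists_eq_add_of_le h3
  nlinarith [Nat.zero_le (e * j), Nat.zero_le (q * j)]

theorem card_closure_le_two_pow (D : Concept NC NR) (H : Hierarchy NR) {m : ℕ}
    (hn : D.length ≤ m) (hk : (D.rolesWith H).card ≤ 2 * m + 1) :
    (D.closure H).card ≤ 2 ^ (2 * m + 4) := by
  have h1 := D.card_closure_le H
  have h2 := D.card_subs_add_numQuant_le
  have h4 : m < 2 ^ m := Nat.lt_two_pow_self
  have h5 : (D.rolesWith H).card * (2 * D.numQuant) ≤ (2 * m + 1) * (2 * m) :=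
    Nat.mul_le_mul hk (by omega)
  have h6 : m * m ≤ 2 ^ m * 2 ^ m := Nat.mul_le_mul h4.le h4.le
  have h7 : m ≤ m * m := Nat.le_mul_self m
  have h8 : 2 ^ (2 * m + 4) = 16 * (2 ^ m * 2 ^ m) := by ring
  rw [h8]
  nlinarith

theorem card_closure_mul_banBound_le (D : Concept NC NR) (H : Hierarchy NR) :
    (D.closure H).card * D.banBound H ≤
      2 ^ 60 * 2 ^ (max D.length ((D.rolesWith H).card / 2)) ^ 2 := by
  set m := max D.length ((D.rolesWith H).card / 2) with hm
  have hn : D.length ≤ m := le_max_left _ _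
  have hk : (D.rolesWith H).card ≤ 2 * m + 1 := by
    have : (D.rolesWith H).card / 2 ≤ m := le_max_right _ _
    omega
  have hcl := D.card_closure_le_two_pow H hn hk
  have hpow : 2 ^ D.length ≤ 2 ^ m := Nat.pow_le_pow_right (by norm_num) hn
  have hpow9 : 2 ^ (9 * D.length) ≤ 2 ^ (9 * m) := Nat.pow_le_pow_right (by norm_num) (by omega)
  have hk' : (D.rolesWith H).card ≤ 2 ^ (m + 1) := by
    have : m + 1 ≤ 2 ^ m := Nat.lt_two_pow_self
    rw [pow_succ]
    omega
  have h1 : (D.closure H).card * 2 ^ D.length ≤ 2 ^ (3 * m + 5) := by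
    refine (Nat.mul_le_mul hcl hpow).trans ?_
    rw [← pow_add]
    exact Nat.pow_le_pow_right (by norm_num) (by omega)
  have h2 : (D.rolesWith H).card * (D.closure H).card ≤ 2 ^ (3 * m + 5) := by
    refine (Nat.mul_le_mul hk' hcl).trans ?_
    rw [← pow_add]
    exact Nat.pow_le_pow_right (by norm_num) (by omega)
  have h3 : 2 ^ D.length ≤ 2 ^ (3 * m + 5) := Nat.pow_le_pow_right (by norm_num) (by omega)
  have h4 : (D.closure H).card * 2 ^ D.length + (D.rolesWith H).card * (D.closure H).card +
      2 ^ D.length ≤ 2 ^ (3 * m + 7) := by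
    have : 2 ^ (3 * m + 7) = 4 * 2 ^ (3 * m + 5) := by ring
    omega
  calc (D.closure H).card * D.banBound H
      ≤ 2 ^ (2 * m + 4) * (2 ^ (3 * m + 7) * 2 ^ (9 * m)) :=
        Nat.mul_le_mul hcl (Nat.mul_le_mul h4 hpow9)
    _ = 2 ^ (14 * m + 11) := by rw [← pow_add, ← pow_add]; congr 1; ring
    _ ≤ 2 ^ (60 + m ^ 2) := by
        refine Nat.pow_le_pow_right (by norm_num) ?_
        zify
        nlinarith [sq_nonneg ((m : ℤ) - 7)]
    _ = _ := pow_add _ _ _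

end Concept

end ALCQPIH

theorem mainTheorem4 :
    ∃ c : ℕ, ∀ (NC : Type u) (NR : Type v) (Q₀ : Set ℚ), (∀ r ∈ Q₀, 0 < r ∧ r < 1) →
      ∀ (H : ALCQPIH.Hierarchy NR) (D : ALCQPIH.Concept NC NR), D.IsConcept Q₀ H →
        -- the length of all sequences of rule applications is bounded
        (∃ N : ℕ, ∀ (m : ℕ) (t : ℕ → ALCQPIH.CTree NC NR),
          ALCQPIH.CTree.IsRun H D.nnf m t → m ≤ N) ∧
        -- the paths and the out-degrees in all generated trees are bounded
        (∀ (m : ℕ) (t : ℕ → ALCQPIH.CTree NC NR), ALCQPIH.CTree.IsRun H D.nnf m t →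
          ∀ x ∈ (t m).nodes,
            x.length ≤ 2 ^ (4 * D.nnf.length * (D.nnf.rolesWith H).card) ∧
            (t m).outDegree x ≤
              c * 2 ^ (max D.nnf.length ((D.nnf.rolesWith H).card / 2)) ^ 2) := by
  refine ⟨2 ^ 60, fun NC NR Q₀ _ H D _ => ?_⟩
  have hD : D.nnf.IsNNF := D.isNNF_nnfAux true
  refine ⟨⟨ALCQPIH.CTree.runBound D.nnf H, fun m t h => h.le_runBound hD⟩, fun m t h x hx => ?_⟩
  have hb := h.bounded hD m le_rfl
  refine ⟨?_, (hb.outDegree_le x hx).trans (D.nnf.card_closure_mul_banBound_le H)⟩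
  rcases hb.depth x hx with rfl | ⟨hk, hl⟩
  · exact Nat.zero_le _
  · exact hl.trans (Nat.pow_le_pow_right (by norm_num) (D.nnf.closure_exponent_le H hk))
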